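/- A *continuous monoid* (resp. *continuous group*) is a monoid object (resp. group object) in the $\infty$-category of spaces; discrete monoids and groups are regarded as continuous ones, and pushouts and group-completions are taken in the $\infty$-category of continuous monoids. Let $\mathbb N^\times$ be the multiplicative monoid of positive integers and $\mathbb Q^\times_{>0}$ the multiplicative group of positive rationals. Let $E_2(\mathbb Z)$ (resp. $E_2^+(\mathbb Z)$) be the monoid of integer $2\times2$ matrices with nonzero (resp. positive) determinant, and let $GL_2^+$ denote the invertible $2\times 2$ matrices with positive determinant. Let $\widetilde{GL}{}_2^+(\mathbb R)\to GL_2^+(\mathbb R)$ be the universal cover, and let the discrete group $\widetilde{GL}{}_2^+(\mathbb Q)$ and the discrete monoid $\widetilde E{}_2^+(\mathbb Z)$ (the braid monoid) be its pullbacks along $GL_2^+(\mathbb Q)\to GL_2^+(\mathbb R)$ and $E_2^+(\mathbb Z)\to GL_2^+(\mathbb R)$. Let $\widetilde{\mathrm{scalars}}$ denote the restrictions to $\mathbb N^\times$ and $\mathbb Q_{>0}^\times$ of the unique homomorphism $\mathbb R_{>0}^\times\to\widetilde{GL}{}_2^+(\mathbb R)$ that lifts the inclusion of $\mathbb R_{>0}^\times$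 in $GL_2^+(\mathbb R)$ as scalar matrices. **Proposition.** Both of the commutative squares $$\begin{array}{ccc}\mathbb N^\times&\xrightarrow{\ \mathrm{scalars}\ }&E_2(\mathbb Z)\\ \downarrow&&\downarrow\\ \mathbb Q_{>0}^\times&\xrightarrow{\ \mathrm{scalars}\ }&GL_2(\mathbb Q)\end{array}\qquad\text{and}\qquad \begin{array}{ccc}\mathbb N^\times&\xrightarrow{\ \widetilde{\mathrm{scalars}}\ }&\widetilde E{}_2^+(\mathbb Z)\\ \downarrow&&\downarrow\\ \mathbb Q_{>0}^\times&\xrightarrow{\ \widetilde{\mathrm{scalars}}\ }&\widetilde{GL}{}_2^+(\mathbb Q)\end{array}$$ are pushouts among continuous monoids. Moreover, each of the homomorphisms $\mathbb N^\times\to\mathbb Q_{>0}^\times$, $E_2(\mathbb Z)\to GL_2(\mathbb Q)$, $\widetilde E{}_2^+(\mathbb Z)\to\widetilde{GL}{}_2^+(\mathbb Q)$ and $E_2^+(\mathbb Z)\to GL_2^+(\mathbb Q)$ is a group-completion among continuous monoids. -/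

import Mathlib

open CategoryTheory Opposite Simplicial Matrix

noncomputable section

namespace ContMonoid

/-! ### Spaces: simplicial sets up to homotopy -/

/-- Kan fibrations of simplicial sets. -/
def IsKanFibration {S T : SSet.{0}} (f : S ⟶ T) : Prop :=
  SSet.modelCategoryQuillen.J.rlp f

/-- Trivial Kan fibrations: the maps with the right lifting property against all
boundary inclusions, that is, the Kan fibrations that are weak homotopy equivalences. -/
def IsTrivialFibration {S T : SSet.{0}} (f : S ⟶ T) : Prop :=
  SSet.modelCategoryQuillen.I.rlp f

/-- Simplicial homotopy equivalences.  Below this is only used between Kan complexes, where it is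
the same as being an equivalence in the infinity-category of spaces. -/
def IsEquivalence {S T : SSet.{0}} (f : S ⟶ T) : Prop :=
  ∃ g : T ⟶ S, Nonempty (SSet.Homotopy (f ≫ g) (𝟙 S)) ∧ Nonempty (SSet.Homotopy (g ≫ f) (𝟙 T))

/-- A square of Kan complexes, with sides `t : P ⟶ S`, `b : P ⟶ T`, `f : S ⟶ U`, `g : T ⟶ U`,
is a homotopy pullback: it commutes, and after replacing `f` by a Kan fibration `p : S' ⟶ U`
the comparison map from `P` to the fibre product `S' ×_U T` is an equivalence. -/
def IsHomotopyPullback {P S T U : SSet.{0}} (t : P ⟶ S) (b : P ⟶ T) (f : S ⟶ U) (g : T ⟶ U) :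
    Prop :=
  ∃ (comm : t ≫ f = b ≫ g) (S' : SSet.{0}) (j : S ⟶ S') (p : S' ⟶ U) (fac : j ≫ p = f),
    IsEquivalence j ∧ IsKanFibration p ∧
      IsEquivalence (Limits.pullback.lift (f := p) (g := g) (t ≫ j) b
        (by rw [Category.assoc, fac, comm]))

/-! ### Continuous monoids: monoid objects in spaces

A simplicial object in spaces is presented by a bisimplicial set `X`.  The outer index is the space
direction and the inner one is the simplicial direction: `X.obj (op ⦋n⦌)` is the simplicial set
`m ↦ (X_m)_n`, where `X_m` is the `m`-th space. -/

/-- For a simplicial set `K` (regarded as a simplicial discrete space) and a bisimplicial set `X`,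
the simplicial mapping space from `K` to `X`, whose `n`-simplices are the maps from `K` to the
`n`-th row of `X`; a map `K × Δ[n] ⟶ X` of bisimplicial sets is the same thing. -/
def mapSpace (K : SSet.{0}) (X : SimplicialObject SSet.{0}) : SSet.{0} :=
  (X : SimplexCategoryᵒᵖ ⥤ SSet.{0}) ⋙ coyoneda.obj (op K)

/-- Restriction of mapping spaces along a map of simplicial sets. -/
def mapSpace.precomp {K L : SSet.{0}} (i : K ⟶ L) (X : SimplicialObject SSet.{0}) :
    mapSpace L X ⟶ mapSpace K X :=
  Functor.whiskerLeft (X : SimplexCategoryᵒᵖ ⥤ SSet.{0}) (coyoneda.map i.op)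

/-- The spine of the standard `m`-simplex: the subcomplex spanned by the vertices and by the
edges from `i` to `i + 1`. -/
def spine (m : ℕ) : (Δ[m] : SSet.{0}).Subcomplex where
  obj _ := {s | (SSet.stdSimplex.asOrderHom s (Fin.last _) : ℕ) ≤
    (SSet.stdSimplex.asOrderHom s 0 : ℕ) + 1}
  map {U V} φ s hs := by
    have h1 : SSet.stdSimplex.asOrderHom s (φ.unop.toOrderHom (Fin.last _)) ≤
        SSet.stdSimplex.asOrderHom s (Fin.last _) :=
      (SSet.stdSimplex.asOrderHom s).monotone (Fin.le_last _)
    have h2 : SSet.stdSimplex.asOrderHom s 0 ≤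
        SSet.stdSimplex.asOrderHom s (φ.unop.toOrderHom 0) :=
      (SSet.stdSimplex.asOrderHom s).monotone (Fin.zero_le _)
    exact le_trans (Fin.le_def.mp h1) (le_trans hs (Nat.add_le_add_right (Fin.le_def.mp h2) 1))

/-- Continuous monoids, i.e. monoid objects in the infinity-category of spaces: simplicial spaces
`X` that satisfy the Segal condition and have contractible `X_0`.  Here `mapSpace Δ[m] X` is `X_m`,
`mapSpace ∂Δ[m] X` is the `m`-th matching object, and `mapSpace (spine m) X` is the iterated fibre
product `X_1 ×_{X_0} ⋯ ×_{X_0} X_1`.  Every simplicial space has a Reedy fibrant replacement; for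
Reedy fibrant `X` the maps in `segal` and `contractible` are Kan fibrations, so for them being a
trivial fibration is the same as being an equivalence. -/
structure IsContinuousMonoid (X : SimplicialObject SSet.{0}) : Prop where
  reedyFibrant : ∀ m : ℕ, IsKanFibration (mapSpace.precomp (SSet.boundary.{0} m).ι X)
  segal : ∀ m : ℕ, IsTrivialFibration (mapSpace.precomp (spine m).ι X)
  contractible : IsTrivialFibration (Limits.terminal.from (mapSpace (Δ[0] : SSet.{0}) X))

/-- Continuous groups: continuous monoids both of whose shear maps, `(x, y) ↦ (x, x y)` and
`(x, y) ↦ (x y, y)`, are equivalences; the shear maps are the restrictions of `X_2` to the two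
outer horns. -/
structure IsContinuousGroup (X : SimplicialObject SSet.{0}) : Prop
    extends IsContinuousMonoid X where
  shear_left : IsTrivialFibration (mapSpace.precomp (SSet.horn.{0} 2 0).ι X)
  shear_right : IsTrivialFibration (mapSpace.precomp (SSet.horn.{0} 2 2).ι X)

/-- The bar construction of a discrete monoid: the nerve of the category with one object and
endomorphism monoid `M`.  Regarded as a simplicial discrete space, it is the continuous monoid
given by the discrete monoid `M`; the space of morphisms of continuous monoids from `M` to a
continuous monoid `X` is `mapSpace (bar M) X`. -/
abbrev bar (M : Type) [Monoid M] : SSet.{0} := nerve (SingleObj M)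

/-- The map induced by a homomorphism on bar constructions. -/
def barMap {M N : Type} [Monoid M] [Monoid N] (f : M →* N) : bar M ⟶ bar N :=
  nerveMap f.toFunctor

/-- The map `Map(N, X) ⟶ Map(M, X)` between spaces of morphisms of continuous monoids induced by
a homomorphism `f : M →* N` of discrete monoids. -/
def restrict {M N : Type} [Monoid M] [Monoid N] (f : M →* N) (X : SimplicialObject SSet.{0}) :
    mapSpace (bar N) X ⟶ mapSpace (bar M) X :=
  mapSpace.precomp (barMap f) X

/-- The square of discrete monoids
```
  A --f--> C
  |i       |h
  B --g--> D
```
is a pushout in the infinity-category of continuous monoids: it commutes, and for every continuous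
monoid `X` the square of mapping spaces into `X` is a homotopy pullback. -/
structure IsPushoutOfContinuousMonoids {A B C D : Type} [Monoid A] [Monoid B] [Monoid C] [Monoid D]
    (f : A →* C) (i : A →* B) (h : C →* D) (g : B →* D) : Prop where
  comm : h.comp f = g.comp i
  isHomotopyPullback : ∀ X : SimplicialObject SSet.{0}, IsContinuousMonoid X →
    IsHomotopyPullback (restrict g X) (restrict h X) (restrict i X) (restrict f X)

/-- The homomorphism `f` from a discrete monoid `M` to a discrete group `G` is the group-completion
of `M` among continuous monoids: it is initial, in the infinity-categorical sense, among morphisms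
from `M` to continuous groups. -/
def IsGroupCompletion {M G : Type} [Monoid M] [Group G] (f : M →* G) : Prop :=
  ∀ X : SimplicialObject SSet.{0}, IsContinuousGroup X → IsEquivalence (restrict f X)

/-! ### The universal cover of a topological group -/

section UniversalCover

variable (G : Type) [Group G] [TopologicalSpace G] [IsTopologicalGroup G]

/-- The group, under pointwise multiplication, of paths in `G` that start at `1`. -/
def pathGroup : Subgroup C(unitInterval, G) where
  carrier := {γ | γ 0 = 1}
  one_mem' := rfl
  mul_mem' {a b} ha hb := by
    change a 0 * b 0 = 1
    rw [show a 0 = 1 from ha, show b 0 = 1 from hb, one_mul]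
  inv_mem' {a} ha := by
    change (a 0)⁻¹ = 1
    rw [show a 0 = 1 from ha, inv_one]

/-- Homotopy of paths relative to the end points is compatible with pointwise multiplication. -/
def pathCon : Con (pathGroup G) where
  r a b := ContinuousMap.HomotopicRel a.1 b.1 {0, 1}
  iseqv := ⟨fun a => ContinuousMap.HomotopicRel.refl a.1,
    fun h => ContinuousMap.HomotopicRel.symm h,
    fun h h' => ContinuousMap.HomotopicRel.trans h h'⟩
  mul' := by
    rintro a b c d ⟨H⟩ ⟨K⟩
    exact ⟨{
      toFun := fun p => H p * K p
      continuous_toFun := H.continuous.mul K.continuous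
      map_zero_left := fun x => by
        rw [H.apply_zero, K.apply_zero]; rfl
      map_one_left := fun x => by
        rw [H.apply_one, K.apply_one]; rfl
      prop' := fun t x hx => by
        change H (t, x) * K (t, x) = a.1 x * c.1 x
        rw [H.eq_fst t hx, K.eq_fst t hx] }⟩

/-- The universal cover of a (connected, locally nice) topological group `G`, as a group:
paths starting at `1` modulo homotopy relative to the end points. -/
def UniversalCover : Type := (pathCon G).Quotient

instance : Group (UniversalCover G) := inferInstanceAs (Group (pathCon G).Quotient)

/-- The covering homomorphism: the end point of a path. -/
def UniversalCover.proj : UniversalCover G →* G :=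
  (pathCon G).lift
    { toFun := fun γ => γ.1 1
      map_one' := rfl
      map_mul' := fun _ _ => rfl }
    (by
      intro a b h
      exact ContinuousMap.HomotopicRel.fst_eq_snd h (by simp))

/-- The class of a path. -/
def UniversalCover.mk : pathGroup G →* UniversalCover G := (pathCon G).mk'

end UniversalCover

/-! ### Matrices -/

/-- The multiplicative group of positive elements of an ordered field. -/
abbrev Pos (F : Type) [Field F] [LinearOrder F] : Type := {x : F // 0 < x}

/-- The inclusion of the multiplicative monoid of positive integers in that of positive
rationals. -/
def natToRat : ℕ+ →* Pos ℚ where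
  toFun n := ⟨(n : ℕ), by exact_mod_cast n.pos⟩
  map_one' := by ext; simp
  map_mul' a b := by ext; simp

/-- Base change of positive rationals to positive reals. -/
def ratToReal : Pos ℚ →* Pos ℝ where
  toFun q := ⟨(q.1 : ℝ), by exact_mod_cast q.2⟩
  map_one' := by ext; simp
  map_mul' a b := by ext; simp

/-- The monoid `E₂(ℤ)` of integer `2 × 2` matrices with nonzero determinant. -/
def E2 : Submonoid (Matrix (Fin 2) (Fin 2) ℤ) where
  carrier := {A | A.det ≠ 0}
  one_mem' := by simp
  mul_mem' {A B} hA hB := by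
    change (A * B).det ≠ 0
    rw [det_mul]
    exact mul_ne_zero hA hB

/-- The monoid `E₂⁺(ℤ)` of integer `2 × 2` matrices with positive determinant. -/
def E2Pos : Submonoid (Matrix (Fin 2) (Fin 2) ℤ) where
  carrier := {A | 0 < A.det}
  one_mem' := by simp
  mul_mem' {A B} hA hB := by
    change 0 < (A * B).det
    rw [det_mul]
    exact mul_pos hA hB

theorem det_intCast (A : Matrix (Fin 2) (Fin 2) ℤ) :
    ((Int.castRingHom ℚ).mapMatrix A).det = (A.det : ℚ) :=
  ((Int.castRingHom ℚ).map_det A).symm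

/-- The homomorphism `E₂(ℤ) → GL₂(ℚ)` that regards an integer matrix as a rational one. -/
def e2ToGL : E2 →* GL (Fin 2) ℚ where
  toFun A := GeneralLinearGroup.mkOfDetNeZero ((Int.castRingHom ℚ).mapMatrix A.1)
    (by rw [det_intCast]; exact_mod_cast A.2)
  map_one' := Units.ext (map_one (Int.castRingHom ℚ).mapMatrix)
  map_mul' A B := Units.ext (map_mul (Int.castRingHom ℚ).mapMatrix A.1 B.1)

/-- The homomorphism `E₂⁺(ℤ) → GL₂⁺(ℚ)` that regards an integer matrix as a rational one. -/
def e2PosToGLPos : E2Pos →* GLPos (Fin 2) ℚ where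
  toFun A := ⟨GeneralLinearGroup.mkOfDetNeZero ((Int.castRingHom ℚ).mapMatrix A.1)
    (by rw [det_intCast]; exact_mod_cast (ne_of_gt A.2 : A.1.det ≠ 0)), by
      rw [mem_glpos]
      change 0 < ((Int.castRingHom ℚ).mapMatrix A.1).det
      rw [det_intCast]
      exact_mod_cast A.2⟩
  map_one' := Subtype.ext (Units.ext (map_one (Int.castRingHom ℚ).mapMatrix))
  map_mul' A B := Subtype.ext (Units.ext (map_mul (Int.castRingHom ℚ).mapMatrix A.1 B.1))

/-- The inclusion `GL₂⁺(ℚ) → GL₂⁺(ℝ)`. -/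
def glPosRatToReal : GLPos (Fin 2) ℚ →* GLPos (Fin 2) ℝ :=
  ((GeneralLinearGroup.map (algebraMap ℚ ℝ)).comp (GLPos (Fin 2) ℚ).subtype).codRestrict _ (by
    intro A
    rw [mem_glpos]
    have h : (0 : ℚ) < (GeneralLinearGroup.det A.1 : ℚ) := (mem_glpos A.1).1 A.2
    change (0 : ℝ) < (GeneralLinearGroup.det (GeneralLinearGroup.map (algebraMap ℚ ℝ) A.1) : ℝ)
    rw [GeneralLinearGroup.map_det]
    change (0 : ℝ) < algebraMap ℚ ℝ (GeneralLinearGroup.det A.1 : ℚ)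
    simpa using h)

/-- Positive integers as scalar matrices in `E₂(ℤ)`. -/
def natScalars : ℕ+ →* E2 where
  toFun n := ⟨Matrix.scalar (Fin 2) ((n : ℕ) : ℤ), by
    change (Matrix.scalar (Fin 2) ((n : ℕ) : ℤ)).det ≠ 0
    rw [Matrix.scalar_apply, det_diagonal]
    simp⟩
  map_one' := Subtype.ext (by simp)
  map_mul' a b := Subtype.ext (by simp)

/-- Positive integers as scalar matrices in `E₂⁺(ℤ)`. -/
def natScalarsPos : ℕ+ →* E2Pos where
  toFun n := ⟨Matrix.scalar (Fin 2) ((n : ℕ) : ℤ), by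
    change 0 < (Matrix.scalar (Fin 2) ((n : ℕ) : ℤ)).det
    rw [Matrix.scalar_apply, det_diagonal]
    simp⟩
  map_one' := Subtype.ext (by simp)
  map_mul' a b := Subtype.ext (by simp)

section Scalars

variable (F : Type) [Field F] [LinearOrder F] [IsStrictOrderedRing F]

/-- Positive elements of a field as units. -/
def posToUnits : Pos F →* Fˣ where
  toFun x := Units.mk0 x.1 x.2.ne'
  map_one' := Units.ext rfl
  map_mul' _ _ := Units.ext rfl

/-- Positive elements of `F` as scalar matrices in `GL₂(F)`. -/
def scalarsGL : Pos F →* GL (Fin 2) F :=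
  (GeneralLinearGroup.scalar (Fin 2)).comp (posToUnits F)

/-- Positive elements of `F` as scalar matrices in `GL₂⁺(F)`. -/
def scalarsGLPos : Pos F →* GLPos (Fin 2) F :=
  (scalarsGL F).codRestrict _ (by
    intro x
    rw [mem_glpos]
    change 0 < (Matrix.scalar (Fin 2) x.1).det
    have := x.2
    simp
    positivity)

end Scalars

/-! ### The universal cover of `GL₂⁺(ℝ)`, the braid monoid and the lifted scalars -/

/-- The universal cover of `GL₂⁺(ℝ)`. -/
abbrev GLPosRealCover : Type := UniversalCover (GLPos (Fin 2) ℝ)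

/-- The universal cover of `GL₂⁺(ℚ)`: the pullback of the universal cover of `GL₂⁺(ℝ)` along
`GL₂⁺(ℚ) → GL₂⁺(ℝ)`. -/
def GLPosRatCover : Subgroup (GLPos (Fin 2) ℚ × GLPosRealCover) :=
  (glPosRatToReal.comp (MonoidHom.fst _ _)).eqLocus
    ((UniversalCover.proj _).comp (MonoidHom.snd _ _))

/-- The braid monoid: the pullback of the universal cover of `GL₂⁺(ℝ)` along
`E₂⁺(ℤ) → GL₂⁺(ℝ)`. -/
def BraidMonoid : Submonoid (E2Pos × GLPosRealCover) :=
  ((glPosRatToReal.comp e2PosToGLPos).comp (MonoidHom.fst _ _)).eqLocusM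
    ((UniversalCover.proj _).comp (MonoidHom.snd _ _))

/-- The homomorphism from the braid monoid to the universal cover of `GL₂⁺(ℚ)` that lifts
`E₂⁺(ℤ) → GL₂⁺(ℚ)`. -/
def braidToCover : BraidMonoid →* GLPosRatCover where
  toFun x := ⟨(e2PosToGLPos x.1.1, x.1.2), x.2⟩
  map_one' := Subtype.ext (Prod.ext (map_one e2PosToGLPos) rfl)
  map_mul' x y := Subtype.ext (Prod.ext (map_mul e2PosToGLPos x.1.1 y.1.1) rfl)

theorem continuous_scalarsGLPos : Continuous (scalarsGLPos ℝ) := by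
  refine Continuous.subtype_mk ?_ _
  refine Units.continuous_iff.2 ⟨?_, ?_⟩
  · change Continuous fun x : Pos ℝ => Matrix.scalar (Fin 2) x.1
    exact Continuous.matrix_diagonal (continuous_pi fun _ => continuous_subtype_val)
  · change Continuous fun x : Pos ℝ => Matrix.scalar (Fin 2) x.1⁻¹
    exact Continuous.matrix_diagonal
      (continuous_pi fun _ => continuous_subtype_val.inv₀ fun x => x.2.ne')

/-- The path `t ↦ r ^ t` of scalar matrices, from `1` to `r`. -/
def scalarPath : Pos ℝ →* pathGroup (GLPos (Fin 2) ℝ) where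
  toFun r := ⟨⟨fun t => scalarsGLPos ℝ ⟨r.1 ^ (t : ℝ), Real.rpow_pos_of_pos r.2 _⟩,
      continuous_scalarsGLPos.comp (Continuous.subtype_mk
        (Continuous.rpow continuous_const continuous_subtype_val fun _ => Or.inl r.2.ne') _)⟩, by
    change scalarsGLPos ℝ ⟨r.1 ^ ((0 : unitInterval) : ℝ), _⟩ = 1
    rw [← map_one (scalarsGLPos ℝ)]
    congr 1
    ext
    simp⟩
  map_one' := by
    ext t : 2
    change scalarsGLPos ℝ ⟨(1 : ℝ) ^ (t : ℝ), _⟩ = 1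
    rw [← map_one (scalarsGLPos ℝ)]
    congr 1
    ext
    simp
  map_mul' r s := by
    ext t : 2
    change scalarsGLPos ℝ ⟨(r.1 * s.1) ^ (t : ℝ), _⟩ = scalarsGLPos ℝ _ * scalarsGLPos ℝ _
    rw [← map_mul (scalarsGLPos ℝ)]
    congr 1
    ext
    exact Real.mul_rpow r.2.le s.2.le

/-- The lift of the scalars `ℝ_{>0} → GL₂⁺(ℝ)` to a homomorphism to the universal cover.  It is the
only one, because `ℝ_{>0}` is divisible and the kernel of the covering is infinite cyclic. -/
def scalarsRealLift : Pos ℝ →* GLPosRealCover := (UniversalCover.mk _).comp scalarPath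

theorem proj_scalarsRealLift (r : Pos ℝ) :
    UniversalCover.proj _ (scalarsRealLift r) = scalarsGLPos ℝ r := by
  change scalarsGLPos ℝ ⟨r.1 ^ ((1 : unitInterval) : ℝ), _⟩ = scalarsGLPos ℝ r
  congr 1
  ext
  simp

theorem glPosRatToReal_scalars (q : Pos ℚ) :
    glPosRatToReal (scalarsGLPos ℚ q) = scalarsGLPos ℝ (ratToReal q) := by
  refine Subtype.ext (Units.ext ?_)
  change (algebraMap ℚ ℝ).mapMatrix (Matrix.scalar (Fin 2) q.1) = Matrix.scalar (Fin 2) (q.1 : ℝ)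
  ext i j
  by_cases h : i = j <;> simp [h]

theorem e2PosToGLPos_scalars (n : ℕ+) :
    e2PosToGLPos (natScalarsPos n) = scalarsGLPos ℚ (natToRat n) := by
  refine Subtype.ext (Units.ext ?_)
  change (Int.castRingHom ℚ).mapMatrix (Matrix.scalar (Fin 2) ((n : ℕ) : ℤ)) =
    Matrix.scalar (Fin 2) ((n : ℕ) : ℚ)
  ext i j
  by_cases h : i = j <;> simp [h]

/-- The lifted scalars `ℚ_{>0} → GL₂⁺(ℚ)~`. -/
def scalarsRatLift : Pos ℚ →* GLPosRatCover :=
  ((scalarsGLPos ℚ).prod (scalarsRealLift.comp ratToReal)).codRestrict _ fun q => by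
    change glPosRatToReal (scalarsGLPos ℚ q) = UniversalCover.proj _ (scalarsRealLift (ratToReal q))
    rw [glPosRatToReal_scalars, proj_scalarsRealLift]

/-- The lifted scalars from the positive integers to the braid monoid. -/
def natScalarsLift : ℕ+ →* BraidMonoid :=
  (natScalarsPos.prod (scalarsRealLift.comp (ratToReal.comp natToRat))).codRestrict _ fun n => by
    change glPosRatToReal (e2PosToGLPos (natScalarsPos n)) =
      UniversalCover.proj _ (scalarsRealLift (ratToReal (natToRat n)))
    rw [e2PosToGLPos_scalars, glPosRatToReal_scalars, proj_scalarsRealLift]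

end ContMonoid

end

open ContMonoid

/-!
Restriction of mapping spaces along a map `K ⟶ L` of simplicial sets is a trivial fibration for a
class `localClass X` of maps that depends on `X`. A bisimplicial set can be read in either
direction, so this class is defined by a left lifting property (`hasLiftingProperty_precomp_iff`);
hence it is closed under pushouts, coproducts and transfinite compositions, and if `X` is Reedy
fibrant, it has a cancellation property (`localClass_of_comp`). If `X` is a continuous monoid it
contains the inner horn inclusions, and if `X` is a continuous group it also contains the last horn
inclusions of dimension at least two (`localClass_inner_horn`, `localClass_last_horn`). It
therefore suffices to show the following for a discrete group `G` with a submonoid `M` and a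
subgroup `Q` of scalars: the bar construction of `G` arises from that of `M` by filling inner and
last horns, and from the union of those of `M` and `Q` by filling inner horns only.

A simplex of the bar construction of `G` is a word in `G` up to right translation. With `a ≤ b` if
`b ∈ M a`, the simplices of the bar construction of `M` are the increasing words, and those of the
bar construction of `Q` are the words whose letters are scalar multiples of each other. The only
property needed is the existence of denominators: among the scalar multiples of `b` that are above
both `a` and `b` there is a least one (`ScaledPreorder.exists_lub`). For matrices over `ℚ` this is
the least common denominator of the entries of `b a⁻¹`, and for the universal cover it is the same
statement, since the cover of the integral matrices is the full preimage.

Least upper bounds are used to fill horns as follows. A word that is not increasing has a preferred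
place where a least upper bound can be inserted: if its first block of multiples is not increasing,
the least upper bound of an initial segment of that block, after its last letter that is not above
its predecessors; otherwise the least upper bound of `a` and `b` in the class of `b`, where `b` is
the first letter that breaks monotonicity and `a` is a letter of the increasing segment before it.
Words where that letter is missing are paired with the words where it is present
(`ScaledPreorder.exists_isValid`), and a lexicographic rank shows that all other faces of the
larger word are filled before it (`ScaledPreorder.IsValid.eq_or_rank_lt`). This is a regular
pairing in the sense of Moss. The inserted letter is never the first one, and it is the last one
only if all letters are scalar multiples of each other, that is, in words from `Q`. For the pushout
squares it remains to note that the union of the bar constructions of `M` and `Q` is a pushout over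
that of `M ∩ Q`, the positive integers (`isPushout_range_sup`).
-/

noncomputable section

namespace ContMonoid

/-! ### Lifting properties of mapping spaces -/

/-- The transpose of a bisimplicial set. -/
def transpose (X : SimplicialObject SSet.{0}) : SimplicialObject SSet.{0} :=
  Functor.flip (C := SimplexCategoryᵒᵖ) (D := SimplexCategoryᵒᵖ) (E := Type) X

/-- The transpose of a map into a mapping space: both sides are maps `A × L ⟶ X` of bisimplicial
sets. -/
def swap {A L : SSet.{0}} {X : SimplicialObject SSet.{0}} (φ : A ⟶ mapSpace L X) :
    L ⟶ mapSpace A (transpose X) where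
  app k := ↾fun l =>
    { app := fun m => ↾fun a => (show L ⟶ X.obj m from φ.app m a).app k l
      naturality := fun m m' f => by
        ext a
        have := ConcreteCategory.congr_hom (φ.naturality f) a
        exact ConcreteCategory.congr_hom (congr_app this k) l }
  naturality k k' f := by
    ext l
    refine NatTrans.ext (funext fun m => ?_)
    ext a
    exact ConcreteCategory.congr_hom ((show L ⟶ X.obj m from φ.app m a).naturality f) l

lemma swap_precomp {A K L : SSet.{0}} {X : SimplicialObject SSet.{0}} (i : K ⟶ L)
    (φ : A ⟶ mapSpace L X) : swap (φ ≫ mapSpace.precomp i X) = i ≫ swap φ := rfl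

/-- The lifting problem of `a` against restriction along `i` and that of `i` against restriction
along `a` are the same problem, read in the two directions of `X`. -/
theorem hasLiftingProperty_precomp_iff {A B K L : SSet.{0}} (a : A ⟶ B) (i : K ⟶ L)
    (X : SimplicialObject SSet.{0}) :
    HasLiftingProperty a (mapSpace.precomp i X) ↔
      HasLiftingProperty i (mapSpace.precomp a (transpose X)) := by
  suffices h : ∀ {A B K L : SSet.{0}} (a : A ⟶ B) (i : K ⟶ L) (X : SimplicialObject SSet.{0}),
      HasLiftingProperty a (mapSpace.precomp i X) →
      HasLiftingProperty i (mapSpace.precomp a (transpose X)) from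
    ⟨h a i X, h i a (transpose X)⟩
  intro A B K L a i X h
  refine ⟨fun {f g} sq => ?_⟩
  have sq' : CommSq (swap (X := transpose X) g) a (mapSpace.precomp i X)
      (swap (X := transpose X) f) := ⟨congrArg (swap (X := transpose X)) sq.w.symm⟩
  exact ⟨⟨⟨swap (h.sq_hasLift sq').exists_lift.some.l,
    congrArg swap (h.sq_hasLift sq').exists_lift.some.fac_right,
    congrArg swap (h.sq_hasLift sq').exists_lift.some.fac_left⟩⟩⟩

open HomotopicalAlgebra MonoidalCategory Limits

/-- The maps `i` of simplicial sets for which restriction along `i` is a trivial fibration of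
mapping spaces into `X`. -/
def localClass (X : SimplicialObject SSet.{0}) : MorphismProperty SSet.{0} :=
  fun _ _ i => IsTrivialFibration (mapSpace.precomp i X)

/-- The matching maps of the transpose of `X`: a map `i` belongs to `localClass X` when it has the
left lifting property against these. -/
def matchingMaps (X : SimplicialObject SSet.{0}) : MorphismProperty SSet.{0} :=
  .ofHoms fun n : ℕ => mapSpace.precomp (SSet.boundary.{0} n).ι (transpose X)

lemma localClass_eq_llp (X : SimplicialObject SSet.{0}) :
    localClass X = (matchingMaps X).llp := by
  ext K L i
  constructor
  · rintro h _ _ _ ⟨n⟩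
    exact (hasLiftingProperty_precomp_iff _ _ _).1 (h _ ⟨n⟩)
  · rintro h _ _ _ ⟨n⟩
    exact (hasLiftingProperty_precomp_iff _ _ _).2 (h _ ⟨n⟩)

instance (X : SimplicialObject SSet.{0}) : (localClass X).IsMultiplicative := by
  rw [localClass_eq_llp]; infer_instance

instance (X : SimplicialObject SSet.{0}) : (localClass X).RespectsIso := by
  rw [localClass_eq_llp]; infer_instance

instance (X : SimplicialObject SSet.{0}) : (localClass X).IsStableUnderCobaseChange := by
  rw [localClass_eq_llp]; infer_instance

instance (X : SimplicialObject SSet.{0}) :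
    MorphismProperty.IsStableUnderTransfiniteComposition.{0} (localClass X) := by
  rw [localClass_eq_llp]; infer_instance

instance (X : SimplicialObject SSet.{0}) :
    MorphismProperty.IsStableUnderCoproducts.{0} (localClass X) := by
  rw [localClass_eq_llp]; infer_instance

/-- If `X` is Reedy fibrant, restriction along any monomorphism is a Kan fibration. -/
lemma isKanFibration_precomp {X : SimplicialObject SSet.{0}}
    (hX : ∀ m : ℕ, IsKanFibration (mapSpace.precomp (SSet.boundary.{0} m).ι X))
    {K L : SSet.{0}} (i : K ⟶ L) [Mono i] : IsKanFibration (mapSpace.precomp i X) := by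
  intro A B a ha
  rw [hasLiftingProperty_precomp_iff]
  have h : SSet.modelCategoryQuillen.I.rlp (mapSpace.precomp a (transpose X)) := by
    rintro _ _ _ ⟨n⟩
    rw [← hasLiftingProperty_precomp_iff]
    exact hX n a ha
  rw [← SSet.rlp_monomorphisms] at h
  exact h i (MorphismProperty.monomorphisms.infer_property i)

/-! ### Trivial fibrations -/

lemma IsTrivialFibration.hasLiftingProperty {S T : SSet.{0}} {p : S ⟶ T}
    (hp : IsTrivialFibration p) {A B : SSet.{0}} (i : A ⟶ B) [Mono i] :
    HasLiftingProperty i p := by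
  have h : SSet.modelCategoryQuillen.I.rlp p := hp
  rw [← SSet.rlp_monomorphisms] at h
  exact h i (MorphismProperty.monomorphisms.infer_property i)

open SSet in
open Classical in
/-- Two maps `f`, `g` that agree on a subcomplex `A` define a map on the union of
`X × ∂Δ[1]` and `A × Δ[1]`: it is `f` at `0`, it is `g` at `1`, and it is constant on `A`. -/
def glueEnds {X Y : SSet.{0}} (A : X.Subcomplex) (f g : X ⟶ Y) (h : A.ι ≫ f = A.ι ≫ g) :
    (A.unionProd (boundary 1) : SSet) ⟶ Y where
  app n := ↾fun z => if ∀ i, stdSimplex.asOrderHom z.1.2 i = 0 then f.app n z.1.1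
    else g.app n z.1.1
  naturality n m φ := by
    ext ⟨⟨x, s⟩, hz⟩
    have hz' : s ∈ (boundary.{0} 1).obj n ∨ x ∈ A.obj n := (A.mem_unionProd_iff _ _).1 hz
    change (if ∀ i, stdSimplex.asOrderHom (Δ[1].map φ s) i = 0 then f.app m (X.map φ x)
      else g.app m (X.map φ x)) =
      Y.map φ (if ∀ i, stdSimplex.asOrderHom s i = 0 then f.app n x else g.app n x)
    have hf := ConcreteCategory.congr_hom (f.naturality φ) x
    have hg := ConcreteCategory.congr_hom (g.naturality φ) x
    have hs : ∀ i, stdSimplex.asOrderHom (Δ[1].map φ s) i =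
      stdSimplex.asOrderHom s (φ.unop.toOrderHom i) := fun i => rfl
    by_cases h1 : ∀ i, stdSimplex.asOrderHom s i = 0
    · rw [if_pos h1, if_pos (fun i => (hs i).trans (h1 _))]
      exact hf
    · rw [if_neg h1]
      split_ifs with h2
      · obtain hz' | hz' := hz'
        · refine (hz' fun j => ?_).elim
          obtain rfl | rfl : j = 0 ∨ j = 1 := (by decide : ∀ k : Fin 2, k = 0 ∨ k = 1) j
          · exact ⟨_, h2 0⟩
          · push Not at h1
            obtain ⟨i, hi⟩ := h1
            exact ⟨i, by
              have : ∀ k : Fin 2, k ≠ 0 → k = 1 := by decide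
              exact this _ hi⟩
        · rw [← show g.app m (X.map φ x) = Y.map φ (g.app n x) from hg]
          exact ConcreteCategory.congr_hom (congr_app h m) ⟨X.map φ x, A.map φ hz'⟩
      · exact hg

open SSet in
/-- Homotopies can be lifted through trivial fibrations relative to their ends and to a
subcomplex on which they are constant. -/
lemma IsTrivialFibration.exists_homotopy {S T X : SSet.{0}} {p : S ⟶ T}
    (hp : IsTrivialFibration p) (A : X.Subcomplex) (f g : X ⟶ S) (h : A.ι ≫ f = A.ι ≫ g)
    (hfg : f ≫ p = g ≫ p) :
    ∃ H : X ⊗ Δ[1] ⟶ S, ι₀ ≫ H = f ∧ ι₁ ≫ H = g ∧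
      A.ι ▷ _ ≫ H = CartesianMonoidalCategory.fst _ _ ≫ A.ι ≫ f := by
  have := hp.hasLiftingProperty (A.unionProd (boundary 1)).ι
  have sq : CommSq (glueEnds A f g h) (A.unionProd (boundary 1)).ι p
      (CartesianMonoidalCategory.fst _ _ ≫ f ≫ p) := ⟨by
    ext n ⟨⟨x, s⟩, hz⟩
    have hx := ConcreteCategory.congr_hom (congr_app hfg n) x
    change p.app n (if _ then f.app n x else g.app n x) = p.app n (f.app n x)
    split_ifs
    · rfl
    · exact hx.symm⟩
  have hl : ∀ n (z : (A.unionProd (boundary.{0} 1)).obj n),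
      sq.lift.app n z.1 = (glueEnds A f g h).app n z := fun n z =>
    ConcreteCategory.congr_hom (congr_app sq.fac_left n) z
  refine ⟨sq.lift, ?_, ?_, ?_⟩
  · ext n x
    refine (hl n ⟨ι₀.app n x, (A.mem_unionProd_iff _ _).2 (Or.inl fun h => ?_)⟩).trans ?_
    · obtain ⟨i, hi⟩ := h 1
      exact absurd hi (by
        change ¬ (0 : Fin 2) = 1
        decide)
    · exact if_pos fun i => rfl
  · ext n x
    refine (hl n ⟨ι₁.app n x, (A.mem_unionProd_iff _ _).2 (Or.inl fun h => ?_)⟩).trans ?_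
    · obtain ⟨i, hi⟩ := h 0
      exact absurd hi (by
        change ¬ (1 : Fin 2) = 0
        decide)
    · exact if_neg fun h => absurd (h 0) (by
        change ¬ (1 : Fin 2) = 0
        decide)
  · ext n ⟨x, s⟩
    refine (hl n ⟨(x.1, s), (A.mem_unionProd_iff _ _).2 (Or.inr x.2)⟩).trans ?_
    have hx := ConcreteCategory.congr_hom (congr_app h n) x
    change (if _ then f.app n x.1 else g.app n x.1) = f.app n x.1
    split_ifs
    · rfl
    · exact hx.symm

open SSet in
/-- A Kan fibration `q` is trivial if it becomes so after composition with a trivial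
fibration `p`: a simplex of the base is first lifted through `q ≫ p`, and then the
lift is corrected by lifting a homotopy over `p`. -/
lemma IsTrivialFibration.of_comp {S T U : SSet.{0}} {q : S ⟶ T} {p : T ⟶ U}
    (hq : IsKanFibration q) (hp : IsTrivialFibration p) (hqp : IsTrivialFibration (q ≫ p)) :
    IsTrivialFibration q := by
  rintro _ _ _ ⟨n⟩
  refine ⟨fun {a b} sq => ?_⟩
  have sq₁ : CommSq a (boundary.{0} n).ι (q ≫ p) (b ≫ p) :=
    ⟨by rw [← Category.assoc, sq.w, Category.assoc]⟩
  have := hqp.hasLiftingProperty (boundary.{0} n).ι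
  let c := sq₁.lift
  have hc : (boundary.{0} n).ι ≫ c = a := sq₁.fac_left
  have hc' : c ≫ q ≫ p = b ≫ p := sq₁.fac_right
  obtain ⟨H, H₀, H₁, HA⟩ := hp.exists_homotopy (boundary.{0} n) (c ≫ q) b
    (by rw [← Category.assoc, hc, sq.w]) (by rw [Category.assoc, hc'])
  have hlift : HasLiftingProperty ((boundary.{0} n).unionProd (horn 1 0)).ι q :=
    anodyneExtensions_unionProd_ι _ _ (anodyneExtensions.horn_ι 0) q hq
  have sq₂ : CommSq (((boundary.{0} n).unionProd (horn 1 0)).ι ≫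
      CartesianMonoidalCategory.fst _ _ ≫ c) ((boundary.{0} n).unionProd (horn 1 0)).ι q H := ⟨by
    ext m ⟨⟨x, s⟩, hz⟩
    change q.app m (c.app m x) = H.app m (x, s)
    obtain hs | hx := ((boundary.{0} n).mem_unionProd_iff _ _).1 hz
    · have h0 : s = (const (stdSimplex.obj₀Equiv.{0}.symm (0 : Fin 2)) :
          (Δ[n] : SSet.{0}) ⟶ Δ[1]).app m x := by
        refine stdSimplex.objEquiv.injective (SimplexCategory.Hom.ext _ _ (OrderHom.ext _ _ ?_))
        funext i
        change stdSimplex.asOrderHom s i = 0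
        by_contra hi
        refine hs (Set.eq_univ_of_forall fun j => ?_)
        obtain rfl | rfl : j = 0 ∨ j = 1 := (by decide : ∀ k : Fin 2, k = 0 ∨ k = 1) j
        · exact Or.inr rfl
        · refine Or.inl ⟨i, ?_⟩
          have : ∀ k : Fin 2, k ≠ 0 → k = 1 := by decide
          exact this _ hi
      rw [h0]
      exact (ConcreteCategory.congr_hom (congr_app H₀ m) x).symm
    · exact (ConcreteCategory.congr_hom (congr_app HA m)
        (show ((boundary.{0} n : SSet) ⊗ Δ[1]).obj m from (⟨x, hx⟩, s))).symm⟩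
  refine ⟨⟨⟨ι₁ ≫ sq₂.lift, ?_, ?_⟩⟩⟩
  · rw [← hc]
    ext m x
    exact ConcreteCategory.congr_hom (congr_app sq₂.fac_left m)
      ⟨ι₁.app m x.1, ((boundary.{0} n).mem_unionProd_iff _ _).2 (Or.inr x.2)⟩
  · rw [Category.assoc, sq₂.fac_right, H₁]

open SSet in
lemma nonempty_homotopy_of_eq {S T : SSet.{0}} {f g : S ⟶ T} (h : f = g) :
    Nonempty (SSet.Homotopy f g) := by
  subst h
  exact ⟨RelativeMorphism.Homotopy.refl _⟩

lemma isEquivalence_id (S : SSet.{0}) : IsEquivalence (𝟙 S) :=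
  ⟨𝟙 S, nonempty_homotopy_of_eq (Category.comp_id _), nonempty_homotopy_of_eq (Category.comp_id _)⟩

open SSet in
/-- Trivial fibrations are homotopy equivalences. -/
lemma IsTrivialFibration.isEquivalence {S T : SSet.{0}} {p : S ⟶ T}
    (hp : IsTrivialFibration p) : IsEquivalence p := by
  have := hp.hasLiftingProperty (initial.to T)
  have sq : CommSq (initial.to S) (initial.to T) p (𝟙 T) := ⟨initialIsInitial.hom_ext _ _⟩
  have h : sq.lift ≫ p = 𝟙 T := sq.fac_right
  -- Lifting the constant homotopy of `p` connects `p ≫ sq.lift` to the identity.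
  obtain ⟨H, H₀, H₁, -⟩ := hp.exists_homotopy (⊥ : S.Subcomplex) (p ≫ sq.lift) (𝟙 S)
    (Subcomplex.isInitialBot.hom_ext _ _) (by rw [Category.assoc, h, Category.comp_id,
      Category.id_comp])
  exact ⟨sq.lift, ⟨⟨H, H₀, H₁, by
    ext n ⟨x, s⟩
    exact x.2.elim⟩⟩, nonempty_homotopy_of_eq h⟩

/-- Right cancellation: for Reedy fibrant `X`, a monomorphism `j` belongs to `localClass X` if
`i` and `i ≫ j` do. -/
lemma localClass_of_comp {X : SimplicialObject SSet.{0}}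
    (hX : ∀ m : ℕ, IsKanFibration (mapSpace.precomp (SSet.boundary.{0} m).ι X))
    {K L P : SSet.{0}} {i : K ⟶ L} {j : L ⟶ P} [Mono j] (hi : localClass X i)
    (hij : localClass X (i ≫ j)) : localClass X j :=
  IsTrivialFibration.of_comp (isKanFibration_precomp hX j) hi hij

end ContMonoid

namespace ContMonoid

open SSet Limits

/-! ### Inclusions of subcomplexes -/

/-- Restriction of mapping spaces into `X` along the inclusion of the subcomplex `A` in the
subcomplex `B` is a trivial fibration. -/
def LocalInclusion (X : SimplicialObject SSet.{0}) {K : SSet.{0}} (A B : K.Subcomplex) : Prop :=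
  ∃ h : A ≤ B, localClass X (Subcomplex.homOfLE h)

namespace LocalInclusion

variable {X : SimplicialObject SSet.{0}} {K : SSet.{0}} {A B C : K.Subcomplex}

lemma refl (A : K.Subcomplex) : LocalInclusion X A A :=
  ⟨le_rfl, (localClass X).id_mem _⟩

lemma trans (h : LocalInclusion X A B) (h' : LocalInclusion X B C) : LocalInclusion X A C :=
  ⟨h.1.trans h'.1, (localClass X).comp_mem _ _ h.2 h'.2⟩

/-- The inclusion of `A` in `A ⊔ B` is a pushout of that of `A ⊓ B` in `B`. -/
lemma sup (h : LocalInclusion X (A ⊓ B) B) : LocalInclusion X A (A ⊔ B) := by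
  have sq : Subcomplex.BicartSq (A ⊓ B) A B (A ⊔ B) := ⟨rfl, rfl⟩
  exact ⟨le_sup_left, MorphismProperty.of_isPushout sq.isPushout h.2⟩

lemma ι (h : LocalInclusion X A ⊤) : localClass X A.ι :=
  (localClass X).comp_mem _ _ h.2
    ((localClass X).of_isIso (Subcomplex.topIso K).hom)

lemma of_ι (h : localClass X A.ι) : LocalInclusion X A ⊤ := by
  refine ⟨le_top, ?_⟩
  have : Subcomplex.homOfLE (le_top : A ≤ ⊤) = A.ι ≫ (Subcomplex.topIso K).inv := rfl
  rw [this]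
  exact (localClass X).comp_mem _ _ h ((localClass X).of_isIso _)

lemma cancel (hX : ∀ m : ℕ, IsKanFibration (mapSpace.precomp (SSet.boundary.{0} m).ι X))
    (h : LocalInclusion X A B) (h' : LocalInclusion X A C) (hBC : B ≤ C) :
    LocalInclusion X B C :=
  ⟨hBC, localClass_of_comp hX h.2 h'.2⟩

lemma image {L : SSet.{0}} (h : LocalInclusion X A B) (f : K ⟶ L) [Mono f] :
    LocalInclusion X (A.image f) (B.image f) := by
  refine ⟨Subcomplex.image_monotone f h.1, ?_⟩
  have hmono : ∀ A : K.Subcomplex, IsIso (A.toImage f) := fun A => by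
    have : Mono (A.toImage f) := mono_of_mono_fac (A.toImage_ι f)
    exact isIso_of_mono_of_epi _
  exact ((localClass X).arrow_mk_iso_iff
    (Arrow.isoMk (@asIso _ _ _ _ (A.toImage f) (hmono A)) (@asIso _ _ _ _ (B.toImage f) (hmono B))
      rfl)).1 h.2

end LocalInclusion

/-! ### Spines and horns -/

lemma mem_sup_obj {K : SSet.{0}} (A B : K.Subcomplex) {n} (x : K.obj n) :
    x ∈ (A ⊔ B).obj n ↔ x ∈ A.obj n ∨ x ∈ B.obj n := Iff.rfl

lemma mem_inf_obj {K : SSet.{0}} (A B : K.Subcomplex) {n} (x : K.obj n) :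
    x ∈ (A ⊓ B).obj n ↔ x ∈ A.obj n ∧ x ∈ B.obj n := Iff.rfl

lemma mem_iSup_obj {K : SSet.{0}} {ι : Type*} (A : ι → K.Subcomplex) {n} (x : K.obj n) :
    x ∈ (⨆ i, A i).obj n ↔ ∃ i, x ∈ (A i).obj n := by simp

variable {n : ℕ}

lemma subcomplex_ext {A B : (Δ[n] : SSet.{0}).Subcomplex}
    (h : ∀ (d : ℕ) (x : (Δ[n] : SSet.{0}) _⦋d⦌), x ∈ A.obj _ ↔ x ∈ B.obj _) : A = B := by
  ext ⟨m⟩ x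
  induction m with | _ d
  exact h d x

lemma mem_face {S : Finset (Fin (n + 1))} {d : ℕ} (x : (Δ[n] : SSet.{0}) _⦋d⦌) :
    x ∈ (stdSimplex.face S).obj _ ↔ ∀ i, stdSimplex.asOrderHom x i ∈ S :=
  stdSimplex.mem_face_iff S x

/-- The spine of the face spanned by `S`: it consists of the simplices that do not
jump over an element of `S`. -/
def faceSpine (S : Finset (Fin (n + 1))) : (Δ[n] : SSet.{0}).Subcomplex where
  obj m := (stdSimplex.face S).obj m ∩ {s | ∀ j ∈ S, stdSimplex.asOrderHom s 0 < j →
    ¬ j < stdSimplex.asOrderHom s (Fin.last _)}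
  map {U V} φ s hs := by
    refine ⟨(stdSimplex.face S).map φ hs.1, fun j hj h h' => hs.2 j hj ?_ ?_⟩
    · exact lt_of_le_of_lt ((stdSimplex.asOrderHom s).monotone (Fin.zero_le _)) h
    · exact lt_of_lt_of_le h' ((stdSimplex.asOrderHom s).monotone (Fin.le_last _))

lemma mem_faceSpine {S : Finset (Fin (n + 1))} {d : ℕ} (x : (Δ[n] : SSet.{0}) _⦋d⦌) :
    x ∈ (faceSpine S).obj _ ↔ (∀ i, stdSimplex.asOrderHom x i ∈ S) ∧
      ∀ j ∈ S, stdSimplex.asOrderHom x 0 < j → ¬ j < stdSimplex.asOrderHom x (Fin.last d) :=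
  and_congr (mem_face x) Iff.rfl

section

variable {m : ℕ} (e : Fin (m + 1) ↪o Fin (n + 1))

/-- The map of standard simplices given by an order embedding. -/
def simplexMap : (Δ[m] : SSet.{0}) ⟶ Δ[n] :=
  SSet.stdSimplex.map (SimplexCategory.mkHom e.toOrderHom)

instance : Mono (simplexMap e) := by
  have : ∀ m, Mono ((simplexMap e).app m) := fun m => by
    rw [mono_iff_injective]
    intro x y h
    refine stdSimplex.objEquiv.injective (SimplexCategory.Hom.ext _ _ (OrderHom.ext _ _ ?_))
    funext i
    exact e.injective (DFunLike.congr_fun (congrArg stdSimplex.asOrderHom h) i)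
  exact NatTrans.mono_of_mono_app _

lemma mem_image_simplexMap {A : (Δ[m] : SSet.{0}).Subcomplex} {d : ℕ}
    (x : (Δ[n] : SSet.{0}) _⦋d⦌) :
    x ∈ (A.image (simplexMap e)).obj _ ↔
      ∃ y, y ∈ A.obj _ ∧ ∀ i, e (stdSimplex.asOrderHom y i) = stdSimplex.asOrderHom x i := by
  constructor
  · rintro ⟨y, hy, rfl⟩
    exact ⟨y, hy, fun i => rfl⟩
  · rintro ⟨y, hy, h⟩
    refine ⟨y, hy, ?_⟩
    refine stdSimplex.objEquiv.injective (SimplexCategory.Hom.ext _ _ (OrderHom.ext _ _ ?_))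
    funext i
    exact h i

lemma exists_of_forall_mem_range {d : ℕ} (x : (Δ[n] : SSet.{0}) _⦋d⦌)
    (hx : ∀ i, stdSimplex.asOrderHom x i ∈ Set.range e) :
    ∃ y : (Δ[m] : SSet.{0}) _⦋d⦌,
      ∀ i, e (stdSimplex.asOrderHom y i) = stdSimplex.asOrderHom x i := by
  choose f hf using hx
  exact ⟨stdSimplex.objMk ⟨f, fun i j hij => e.le_iff_le.1 (by
    rw [hf, hf]; exact (stdSimplex.asOrderHom x).monotone hij)⟩, hf⟩

end

section

variable {X : SimplicialObject SSet.{0}}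

/-- The Segal condition, transported to the face spanned by `S`. -/
lemma localInclusion_faceSpine (hX : IsContinuousMonoid X) (S : Finset (Fin (n + 1))) :
    LocalInclusion X (faceSpine S) (stdSimplex.face S) := by
  obtain rfl | hS := S.eq_empty_or_nonempty
  · convert LocalInclusion.refl (X := X) (faceSpine (n := n) ∅)
    refine subcomplex_ext fun d x => ?_
    rw [mem_face, mem_faceSpine]
    simp
  obtain ⟨m, hm⟩ : ∃ m, S.card = m + 1 := ⟨S.card - 1, by have := hS.card_pos; omega⟩
  let e := S.orderEmbOfFin hm
  have he : Set.range e = S := S.range_orderEmbOfFin hm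
  have h := (LocalInclusion.of_ι (hX.segal m)).image (simplexMap e)
  convert h using 1
  · refine subcomplex_ext fun d x => ?_
    rw [mem_faceSpine, mem_image_simplexMap]
    constructor
    · rintro ⟨h₁, h₂⟩
      obtain ⟨y, hy⟩ := exists_of_forall_mem_range e x (fun i => by rw [he]; exact h₁ i)
      refine ⟨y, ?_, hy⟩
      change (stdSimplex.asOrderHom y (Fin.last d) : ℕ) ≤ (stdSimplex.asOrderHom y 0 : ℕ) + 1
      by_contra! hlt
      have hlt' := (stdSimplex.asOrderHom y (Fin.last d)).isLt
      let k : Fin (m + 1) := ⟨(stdSimplex.asOrderHom y 0 : ℕ) + 1, hlt.trans hlt'⟩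
      refine h₂ (e k) (by rw [← Finset.mem_coe, ← he]; exact ⟨k, rfl⟩) ?_ ?_
      · rw [← hy 0, e.lt_iff_lt]
        exact Fin.lt_def.2 (Nat.lt_succ_self _)
      · rw [← hy (Fin.last d), e.lt_iff_lt]
        exact Fin.lt_def.2 hlt
    · rintro ⟨y, hy, h⟩
      refine ⟨fun i => by rw [← h, ← Finset.mem_coe, ← he]; exact ⟨_, rfl⟩, fun j hj h₁ h₂ => ?_⟩
      rw [← Finset.mem_coe, ← he] at hj
      obtain ⟨k, rfl⟩ := hj
      rw [← h, e.lt_iff_lt, Fin.lt_def] at h₁ h₂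
      have hy : (stdSimplex.asOrderHom y (Fin.last d) : ℕ) ≤ (stdSimplex.asOrderHom y 0 : ℕ) + 1 :=
        hy
      omega
  · refine subcomplex_ext fun d x => ?_
    rw [mem_face, mem_image_simplexMap]
    constructor
    · intro h
      obtain ⟨y, hy⟩ := exists_of_forall_mem_range e x (fun i => by rw [he]; exact h i)
      exact ⟨y, trivial, hy⟩
    · rintro ⟨y, -, h⟩ i
      rw [← h, ← Finset.mem_coe, ← he]; exact ⟨_, rfl⟩

/-- The union of the two faces of the face `S` spanned by the vertices up to `i` and by the
vertices from `i` on. -/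
def faceSplit (S : Finset (Fin (n + 1))) (i : Fin (n + 1)) : (Δ[n] : SSet.{0}).Subcomplex :=
  stdSimplex.face (S.filter (· ≤ i)) ⊔ stdSimplex.face (S.filter (i ≤ ·))

lemma mem_faceSplit {S : Finset (Fin (n + 1))} {i : Fin (n + 1)} {d : ℕ}
    (x : (Δ[n] : SSet.{0}) _⦋d⦌) :
    x ∈ (faceSplit S i).obj _ ↔ (∀ k, stdSimplex.asOrderHom x k ∈ S) ∧
      ((∀ k, stdSimplex.asOrderHom x k ≤ i) ∨ (∀ k, i ≤ stdSimplex.asOrderHom x k)) := by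
  rw [faceSplit, mem_sup_obj, mem_face, mem_face]
  simp only [Finset.mem_filter, forall_and, and_or_left]

/-- Both the inclusion of the spine of `S` in `faceSplit S i` and that in the whole face are local:
the former is obtained by filling the spines of the two halves. -/
lemma localInclusion_faceSplit (hX : IsContinuousMonoid X) {S : Finset (Fin (n + 1))}
    {i : Fin (n + 1)} (hi : i ∈ S) :
    LocalInclusion X (faceSplit S i) (stdSimplex.face S) := by
  have hmono : ∀ {d : ℕ} (x : (Δ[n] : SSet.{0}) _⦋d⦌) (k : Fin (d + 1)),
      stdSimplex.asOrderHom x 0 ≤ stdSimplex.asOrderHom x k ∧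
      stdSimplex.asOrderHom x k ≤ stdSimplex.asOrderHom x (Fin.last d) := fun x k =>
    ⟨(stdSimplex.asOrderHom x).monotone (Fin.zero_le k),
      (stdSimplex.asOrderHom x).monotone (Fin.le_last k)⟩
  refine LocalInclusion.cancel hX.reedyFibrant (A := faceSpine S) ?_
    (localInclusion_faceSpine hX S) ?_
  · have h₁ :
        LocalInclusion X (faceSpine S) (faceSpine S ⊔ stdSimplex.face (S.filter (· ≤ i))) := by
      refine LocalInclusion.sup ?_
      convert localInclusion_faceSpine hX (S.filter (· ≤ i)) using 1
      refine subcomplex_ext fun d x => ?_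
      rw [mem_inf_obj, mem_faceSpine, mem_faceSpine, mem_face]
      simp only [Finset.mem_filter]
      constructor
      · rintro ⟨h, h'⟩
        exact ⟨h', fun j hj => h.2 j hj.1⟩
      · rintro ⟨h, h'⟩
        exact ⟨⟨fun k => (h k).1, fun j hj h₁ h₂ => h' j ⟨hj, h₂.le.trans (h _).2⟩ h₁ h₂⟩, h⟩
    refine h₁.trans ?_
    convert LocalInclusion.sup (X := X) (A := faceSpine S ⊔ stdSimplex.face (S.filter (· ≤ i)))
      (B := stdSimplex.face (S.filter (i ≤ ·))) ?_ using 1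
    · refine subcomplex_ext fun d x => ?_
      rw [mem_faceSplit, mem_sup_obj, mem_sup_obj, mem_faceSpine, mem_face, mem_face]
      simp only [Finset.mem_filter, forall_and]
      constructor
      · tauto
      · rintro ((h | h) | h)
        · refine ⟨h.1, ?_⟩
          by_contra! h'
          obtain ⟨⟨k, hk⟩, l, hl⟩ := h'
          exact h.2 i hi ((hmono x l).1.trans_lt hl) (hk.trans_le (hmono x k).2)
        · tauto
        · tauto
    · convert localInclusion_faceSpine hX (S.filter (i ≤ ·)) using 1
      refine subcomplex_ext fun d x => ?_
      rw [mem_inf_obj, mem_sup_obj, mem_faceSpine, mem_faceSpine, mem_face, mem_face]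
      simp only [Finset.mem_filter]
      constructor
      · rintro ⟨h | h, h'⟩
        · exact ⟨h', fun j hj => h.2 j hj.1⟩
        · exact ⟨h', fun j hj h₁ h₂ => absurd ((h₂.trans_le (h _).2).trans_le hj.2) (lt_irrefl _)⟩
      · rintro ⟨h, h'⟩
        exact ⟨Or.inl ⟨fun k => (h k).1, fun j hj h₁ h₂ => h' j ⟨hj, (h _).2.trans h₁.le⟩ h₁ h₂⟩, h⟩
  · intro m x hx
    induction m using Opposite.rec with | _ m
    induction m with | _ d
    exact (mem_face x).2 ((mem_faceSplit x).1 hx).1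

/-- If the inclusions `C U ⟶ face U` are local for all `U` between `S \ T` and `S`, then so is
the inclusion of `C S` in its union with the faces of `S` opposite to the vertices in `T`. -/
lemma localInclusion_sup_faces
    (hX : ∀ m : ℕ, IsKanFibration (mapSpace.precomp (SSet.boundary.{0} m).ι X))
    (C : Finset (Fin (n + 1)) → (Δ[n] : SSet.{0}).Subcomplex) (T : Finset (Fin (n + 1))) :
    ∀ S, (∀ U, S \ T ⊆ U → U ⊆ S → LocalInclusion X (C U) (stdSimplex.face U)) →
      (∀ U, S \ T ⊆ U → U ⊆ S → ∀ j ∈ T, C U ⊓ stdSimplex.face (U.erase j) = C (U.erase j)) →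
      LocalInclusion X (C S) (C S ⊔ ⨆ j : T, stdSimplex.face (S.erase j)) := by
  induction T using Finset.induction_on with
  | empty =>
    intro S _ _
    convert LocalInclusion.refl (X := X) (C S)
    simp
  | insert j T hj ih =>
    intro S h₁ h₂
    have hsub : ∀ U, S \ T ⊆ U → S \ insert j T ⊆ U := fun U h k hk => h (by
      simp only [Finset.mem_sdiff, Finset.mem_insert] at hk ⊢; tauto)
    have h := ih S (fun U hU => h₁ U (hsub U hU))
      (fun U hU hU' k hk => h₂ U (hsub U hU) hU' k (Finset.mem_insert_of_mem hk))
    have hsub' : ∀ U, S.erase j \ T ⊆ U → U ⊆ S.erase j → S \ insert j T ⊆ U ∧ U ⊆ S :=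
      fun U h h' => ⟨fun k hk => h (by
        simp only [Finset.mem_sdiff, Finset.mem_insert, Finset.mem_erase] at hk ⊢; tauto),
        h'.trans (Finset.erase_subset _ _)⟩
    have h' := ih (S.erase j) (fun U hU hU' => h₁ U (hsub' U hU hU').1 (hsub' U hU hU').2)
      (fun U hU hU' k hk => h₂ U (hsub' U hU hU').1 (hsub' U hU hU').2 k
        (Finset.mem_insert_of_mem hk))
    have hj' := hsub' (S.erase j) Finset.sdiff_subset subset_rfl
    have h'' := h'.cancel hX (h₁ _ hj'.1 hj'.2) (sup_le (h₁ _ hj'.1 hj'.2).1 (iSup_le fun k =>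
      (stdSimplex.face_le_face_iff _ _).2 (Finset.erase_subset _ _)))
    convert h.trans (LocalInclusion.sup (B := stdSimplex.face (S.erase j)) ?_) using 1
    · refine subcomplex_ext fun d x => ?_
      simp only [mem_sup_obj, mem_iSup_obj, Subtype.exists, Finset.mem_insert, exists_prop,
        exists_eq_or_imp]
      rw [or_assoc]
      exact or_congr_right or_comm
    · convert h'' using 1
      refine subcomplex_ext fun d x => ?_
      rw [← h₂ S Finset.sdiff_subset subset_rfl j (Finset.mem_insert_self _ _)]
      simp only [mem_sup_obj, mem_inf_obj, mem_iSup_obj, Subtype.exists, mem_face, exists_prop,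
        Finset.mem_erase, forall_and]
      constructor
      · rintro ⟨h | ⟨k, hk, h⟩, h'⟩
        · exact Or.inl ⟨h, h'⟩
        · exact Or.inr ⟨k, hk, h.1, h'⟩
      · rintro (h | ⟨k, hk, h, h'⟩)
        · exact ⟨Or.inl h.1, h.2⟩
        · exact ⟨Or.inr ⟨k, hk, h, h'.2⟩, h'⟩

lemma mem_horn {i : Fin (n + 1)} {d : ℕ} (x : (Δ[n] : SSet.{0}) _⦋d⦌) :
    x ∈ (horn n i).obj _ ↔ ∃ j, j ≠ i ∧ ∀ k, stdSimplex.asOrderHom x k ≠ j := by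
  rw [mem_horn_iff, Set.ne_univ_iff_exists_notMem]
  simp only [Set.mem_union, Set.mem_range, Set.mem_singleton_iff, not_or, not_exists]
  exact exists_congr fun j => and_comm

/-- A criterion for horns: if the inclusions `C U ⟶ face U` are local whenever `i ∈ U`, and `C` is
contained in the horn, then the horn is obtained from `C` by filling faces. -/
lemma localClass_horn_of_le
    (hX : ∀ m : ℕ, IsKanFibration (mapSpace.precomp (SSet.boundary.{0} m).ι X))
    (C : Finset (Fin (n + 1)) → (Δ[n] : SSet.{0}).Subcomplex) (i : Fin (n + 1))
    (h₁ : ∀ U, i ∈ U → LocalInclusion X (C U) (stdSimplex.face U))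
    (h₂ : ∀ U, i ∈ U → ∀ j ≠ i, C U ⊓ stdSimplex.face (U.erase j) = C (U.erase j))
    (h₃ : C Finset.univ ≤ horn n i) :
    localClass X (horn.{0} n i).ι := by
  have h := localInclusion_sup_faces hX C (Finset.univ.erase i) Finset.univ
    (fun U hU _ => h₁ U (hU (by simp)))
    (fun U hU _ j hj => h₂ U (hU (by simp)) j (by simpa using hj))
  have heq : C Finset.univ ⊔ ⨆ j : (Finset.univ.erase i : Finset (Fin (n + 1))),
      stdSimplex.face (Finset.univ.erase (j : Fin (n + 1))) = horn.{0} n i := by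
    refine subcomplex_ext fun d x => ?_
    have h₃ := @h₃ _ x
    simp only [mem_sup_obj, mem_iSup_obj, Subtype.exists, mem_face, exists_prop,
      Finset.mem_erase, Finset.mem_univ, and_true]
    rw [mem_horn] at h₃ ⊢
    tauto
  rw [heq] at h
  have h' := h₁ Finset.univ (Finset.mem_univ i)
  rw [stdSimplex.face_univ] at h'
  exact (h.cancel hX h' le_top).ι

/-- Inner horn inclusions are local with respect to continuous monoids. -/
theorem localClass_inner_horn (hX : IsContinuousMonoid X) {i : Fin (n + 1)} (h0 : 0 < i)
    (hn : i < Fin.last n) : localClass X (horn.{0} n i).ι := by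
  refine localClass_horn_of_le hX.reedyFibrant (fun S => faceSplit S i) i
    (fun U hU => localInclusion_faceSplit hX hU) (fun U hU j hj => ?_) ?_
  · refine subcomplex_ext fun d x => ?_
    simp only [mem_inf_obj, mem_faceSplit, mem_face, Finset.mem_erase, forall_and]
    tauto
  · intro m x hx
    induction m using Opposite.rec with | _ m
    induction m with | _ d
    obtain ⟨-, hx | hx⟩ := (mem_faceSplit x).1 hx
    · exact (mem_horn x).2 ⟨_, hn.ne', fun k => ((hx k).trans_lt hn).ne⟩
    · exact (mem_horn x).2 ⟨_, h0.ne, fun k => (h0.trans_le (hx k)).ne'⟩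

/-- The union of the edges of the face `S` that contain the vertex `z`. -/
def faceStar (z : Fin (n + 1)) (S : Finset (Fin (n + 1))) : (Δ[n] : SSet.{0}).Subcomplex :=
  ⨆ x : S, stdSimplex.face {(x : Fin (n + 1)), z}

lemma mem_faceStar {S : Finset (Fin (n + 1))} {z : Fin (n + 1)} {d : ℕ}
    (x : (Δ[n] : SSet.{0}) _⦋d⦌) :
    x ∈ (faceStar z S).obj _ ↔
      ∃ j ∈ S, ∀ k, stdSimplex.asOrderHom x k = j ∨ stdSimplex.asOrderHom x k = z := by
  simp only [faceStar, mem_iSup_obj, mem_face, Subtype.exists, exists_prop, Finset.mem_insert,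
    Finset.mem_singleton]

lemma faceStar_inf_face {S : Finset (Fin (n + 1))} {z j : Fin (n + 1)} (hz : z ∈ S) (hj : j ≠ z) :
    faceStar z S ⊓ stdSimplex.face (S.erase j) = faceStar z (S.erase j) := by
  refine subcomplex_ext fun d x => ?_
  simp only [mem_inf_obj, mem_faceStar, mem_face, Finset.mem_erase]
  constructor
  · rintro ⟨⟨y, hy, h⟩, h'⟩
    by_cases hyj : y = j
    · exact ⟨z, ⟨hj.symm, hz⟩, fun k => Or.inr ((h k).resolve_left fun e =>
        (h' k).1 (e.trans hyj))⟩
    · exact ⟨y, ⟨hyj, hy⟩, h⟩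
  · rintro ⟨y, hy, h⟩
    refine ⟨⟨y, hy.2, h⟩, fun k => ?_⟩
    obtain h | h := h k <;> rw [h]
    · exact hy
    · exact ⟨hj.symm, hz⟩

/-- The last horn of the triangle `x < y < z` is local with respect to continuous groups. -/
lemma localInclusion_triangle (hX : IsContinuousGroup X) {x y z : Fin (n + 1)} (hxy : x < y)
    (hyz : y < z) :
    LocalInclusion X (stdSimplex.face {x, z} ⊔ stdSimplex.face {y, z})
      (stdSimplex.face {x, y, z}) := by
  have hmono : StrictMono ![x, y, z] := by
    rw [Fin.strictMono_iff_lt_succ]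
    intro i
    fin_cases i
    exacts [hxy, hyz]
  let e : Fin 3 ↪o Fin (n + 1) := OrderEmbedding.ofStrictMono _ hmono
  have he : ∀ k, k ∈ Set.range e ↔ k = x ∨ k = y ∨ k = z := fun k => by
    change k ∈ Set.range ![x, y, z] ↔ _
    simp
    tauto
  have h3 : ∀ k : Fin 3, k = 0 ∨ k = 1 ∨ k = 2 := by decide
  have e0 : e 0 = x := rfl
  have e1 : e 1 = y := rfl
  have e2 : e 2 = z := rfl
  have h := (LocalInclusion.of_ι hX.shear_right).image (simplexMap e)
  convert h using 1
  · refine subcomplex_ext fun d s => ?_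
    rw [mem_image_simplexMap]
    simp only [mem_sup_obj, mem_face, Finset.mem_insert, Finset.mem_singleton]
    constructor
    · intro h
      obtain ⟨t, ht⟩ := exists_of_forall_mem_range e s (fun i => by
        rw [he]
        obtain h | h := h <;> have := h i <;> tauto)
      refine ⟨t, (mem_horn t).2 ?_, ht⟩
      obtain h | h := h
      · refine ⟨1, by decide, fun k hk => ?_⟩
        have := h k
        rw [← ht, hk, e1] at this
        exact this.elim hxy.ne' hyz.ne
      · refine ⟨0, by decide, fun k hk => ?_⟩
        have := h k
        rw [← ht, hk, e0] at this
        exact this.elim hxy.ne (hxy.trans hyz).ne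
    · rintro ⟨t, ht, hts⟩
      obtain ⟨j, hj, hjt⟩ := (mem_horn t).1 ht
      simp only [← hts]
      obtain rfl | rfl | rfl := h3 j
      · refine Or.inr fun k => ?_
        obtain h | h | h := h3 (stdSimplex.asOrderHom t k)
        · exact absurd h (hjt k)
        · rw [h]; exact Or.inl e1
        · rw [h]; exact Or.inr e2
      · refine Or.inl fun k => ?_
        obtain h | h | h := h3 (stdSimplex.asOrderHom t k)
        · rw [h]; exact Or.inl e0
        · exact absurd h (hjt k)
        · rw [h]; exact Or.inr e2
      · exact absurd rfl hj
  · refine subcomplex_ext fun d s => ?_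
    rw [mem_image_simplexMap]
    simp only [mem_face, Finset.mem_insert, Finset.mem_singleton, ← he]
    constructor
    · intro h
      obtain ⟨t, ht⟩ := exists_of_forall_mem_range e s h
      exact ⟨t, trivial, ht⟩
    · rintro ⟨t, -, h⟩ i
      exact ⟨_, h i⟩

/-- A simplex of a continuous group is determined by its edges that end in the last vertex `z`. With
`y` and `x` the two vertices before `z`, first the face opposite to `y` is filled by
induction, then the triangle `x < y < z` by the last horn, and the result is compared with
`faceSplit S x`. -/
lemma localInclusion_faceStar (hX : IsContinuousGroup X) {z : Fin (n + 1)}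
    (S : Finset (Fin (n + 1))) (hzS : z ∈ S) (hz : ∀ k ∈ S, k ≤ z) :
    LocalInclusion X (faceStar z S) (stdSimplex.face S) := by
  induction S using Finset.strongInduction with | _ S ih
  by_cases hle : ∃ y, ∀ k ∈ S, k = y ∨ k = z
  · -- `S` has at most two elements, and both sides agree
    obtain ⟨y, hy⟩ := hle
    convert LocalInclusion.refl (X := X) (faceStar z S)
    refine subcomplex_ext fun d x => ?_
    rw [mem_face, mem_faceStar]
    constructor
    · intro h
      by_cases hyS : y ∈ S
      · exact ⟨y, hyS, fun k => hy _ (h k)⟩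
      · exact ⟨z, hzS, fun k => Or.inr ((hy _ (h k)).resolve_left fun e => hyS (e ▸ h k))⟩
    · rintro ⟨j, hj, h⟩ k
      obtain h | h := h k <;> rw [h] <;> assumption
  push Not at hle
  obtain ⟨x₀, hx₀, hx₀z, -⟩ := hle z
  obtain ⟨y, hy, hymax⟩ : ∃ y ∈ S.erase z, ∀ k ∈ S.erase z, k ≤ y :=
    ⟨_, Finset.max'_mem _ ⟨x₀, by simp [hx₀, hx₀z]⟩, fun k hk => Finset.le_max' _ _ hk⟩
  obtain ⟨x₁, hx₁, hx₁y, hx₁z⟩ := hle y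
  obtain ⟨x, hx, hxmax⟩ : ∃ x ∈ (S.erase z).erase y, ∀ k ∈ (S.erase z).erase y, k ≤ x :=
    ⟨_, Finset.max'_mem _ ⟨x₁, by simp [hx₁, hx₁y, hx₁z]⟩, fun k hk => Finset.le_max' _ _ hk⟩
  simp only [Finset.mem_erase] at hx hy hxmax hymax
  have hyz : y < z := lt_of_le_of_ne (hz _ hy.2) hy.1
  have hxy : x < y := lt_of_le_of_ne (hymax _ hx.2) hx.1
  have h₁ : LocalInclusion X (faceStar z S) (faceStar z S ⊔ stdSimplex.face (S.erase y)) := by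
    refine LocalInclusion.sup ?_
    rw [faceStar_inf_face hzS hyz.ne]
    exact ih _ (Finset.erase_ssubset hy.2) (by simp [hzS, hyz.ne']) fun k hk =>
      hz k (Finset.mem_of_mem_erase hk)
  have h₂ : LocalInclusion X (faceStar z S ⊔ stdSimplex.face (S.erase y))
      (stdSimplex.face (S.erase y) ⊔ stdSimplex.face {x, y, z}) := by
    convert LocalInclusion.sup (X := X) (A := faceStar z S ⊔ stdSimplex.face (S.erase y))
      (B := stdSimplex.face {x, y, z}) ?_ using 1
    · refine subcomplex_ext fun d s => ?_
      simp only [mem_sup_obj, mem_faceStar, mem_face, Finset.mem_insert, Finset.mem_singleton,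
        Finset.mem_erase]
      constructor
      · tauto
      · rintro ((⟨j, hj, h⟩ | h) | h)
        · by_cases hjy : j = y
          · subst hjy
            exact Or.inr fun k => Or.inr (h k)
          · refine Or.inl fun k => ?_
            obtain h | h := h k <;> rw [h]
            · exact ⟨hjy, hj⟩
            · exact ⟨hyz.ne', hzS⟩
        · exact Or.inl h
        · exact Or.inr h
    · convert localInclusion_triangle hX hxy hyz using 1
      refine subcomplex_ext fun d s => ?_
      simp only [mem_sup_obj, mem_inf_obj, mem_faceStar, mem_face, Finset.mem_insert,
        Finset.mem_singleton, Finset.mem_erase]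
      constructor
      · rintro ⟨⟨j, hj, h⟩ | h, h'⟩
        · by_cases hjy : j = y
          · subst hjy
            exact Or.inr h
          · refine Or.inl fun k => ?_
            have := h' k
            obtain h | h := h k
            · rw [h] at this ⊢
              tauto
            · exact Or.inr h
        · refine Or.inl fun k => ?_
          have := h k
          have := h' k
          tauto
      · rintro (h | h)
        · exact ⟨Or.inl ⟨x, hx.2.2, h⟩, fun k => (h k).imp_right Or.inr⟩
        · exact ⟨Or.inl ⟨y, hy.2, h⟩, fun k => Or.inr (h k)⟩
  have h₃ : LocalInclusion X (faceSplit S x)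
      (stdSimplex.face (S.erase y) ⊔ stdSimplex.face {x, y, z}) := by
    convert LocalInclusion.sup (X := X) (A := faceSplit S x)
      (B := stdSimplex.face (S.erase y)) ?_ using 1
    · refine subcomplex_ext fun d s => ?_
      simp only [mem_sup_obj, mem_faceSplit, mem_face, Finset.mem_insert, Finset.mem_singleton,
        Finset.mem_erase]
      constructor
      · rintro (h | h)
        · exact Or.inr h
        · refine Or.inl ⟨fun k => ?_, Or.inr fun k => ?_⟩
          · obtain h | h | h := h k <;> rw [h]
            exacts [hx.2.2, hy.2, hzS]
          · obtain h | h | h := h k <;> rw [h]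
            exacts [hxy.le, (hxy.trans hyz).le]
      · rintro (⟨h, h' | h'⟩ | h)
        · exact Or.inl fun k => ⟨((h' k).trans_lt hxy).ne, h k⟩
        · refine Or.inr fun k => ?_
          by_contra! hk
          exact hk.1 (le_antisymm (hxmax _ ⟨hk.2.1, hk.2.2, h k⟩) (h' k))
        · exact Or.inl h
    · convert localInclusion_faceSplit hX.toIsContinuousMonoid (S := S.erase y) (i := x)
        (by simp [hx.2.2, hxy.ne]) using 1
      refine subcomplex_ext fun d s => ?_
      simp only [mem_inf_obj, mem_faceSplit, mem_face, Finset.mem_erase, forall_and]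
      tauto
  have hle : stdSimplex.face (S.erase y) ⊔ stdSimplex.face {x, y, z} ≤
      (stdSimplex.face S : (Δ[n] : SSet.{0}).Subcomplex) := by
    refine sup_le ((stdSimplex.face_le_face_iff _ _).2 (Finset.erase_subset _ _))
      ((stdSimplex.face_le_face_iff _ _).2 fun k hk => ?_)
    simp only [Finset.mem_insert, Finset.mem_singleton] at hk
    obtain rfl | rfl | rfl := hk
    exacts [hx.2.2, hy.2, hzS]
  exact (h₁.trans h₂).trans
    (h₃.cancel hX.reedyFibrant (localInclusion_faceSplit hX.toIsContinuousMonoid hx.2.2) hle)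

/-- The last horn inclusions are local with respect to continuous groups. -/
theorem localClass_last_horn (hX : IsContinuousGroup X) (hn : 2 ≤ n) :
    localClass X (horn.{0} n (Fin.last n)).ι := by
  refine localClass_horn_of_le hX.reedyFibrant (faceStar (Fin.last n)) (Fin.last n)
    (fun U hU => localInclusion_faceStar hX U hU fun k _ => Fin.le_last k)
    (fun U hU j hj => faceStar_inf_face hU hj) ?_
  intro m x hx
  induction m using Opposite.rec with | _ m
  induction m with | _ d
  obtain ⟨j, -, hx⟩ := (mem_faceStar x).1 hx
  obtain ⟨k, hk, hkj⟩ : ∃ k : Fin (n + 1), k ≠ Fin.last n ∧ k ≠ j := by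
    have : ∃ k, k ∉ ({Fin.last n, j} : Finset (Fin (n + 1))) := by
      by_contra! h
      have h₁ := Finset.card_le_two (a := Fin.last n) (b := j)
      rw [Finset.eq_univ_of_forall h] at h₁
      simp at h₁
      omega
    simpa using this
  refine (mem_horn x).2 ⟨k, hk, fun i hi => ?_⟩
  have := hx i
  rw [hi] at this
  exact this.elim hkj hk

end

end ContMonoid

/-! ### Insertion of least upper bounds in words -/

namespace ContMonoid

/-- A preorder `le` with an equivalence relation `sim` ("scalar multiples of each other") such
that `le` is antisymmetric on each class and any two elements `a`, `b` have a least upper bound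
within the class of `b`. -/
structure ScaledPreorder (V : Type*) where
  /-- the preorder -/
  le : V → V → Prop
  /-- the equivalence relation -/
  sim : V → V → Prop
  le_refl (a : V) : le a a
  le_trans {a b c : V} : le a b → le b c → le a c
  sim_refl (a : V) : sim a a
  sim_symm {a b : V} : sim a b → sim b a
  sim_trans {a b c : V} : sim a b → sim b c → sim a c
  antisymm {a b : V} : sim a b → le a b → le b a → a = b
  exists_lub (a b : V) : ∃ u, sim u b ∧ ∀ x, sim x b → (le u x ↔ le a x ∧ le b x)

/-- A word `p ++ a :: mid ++ tl` together with a letter `u` that may be inserted after `a`.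
The flag `block` tells which of the two rules of `IsValid` governs the insertion. -/
@[ext] structure Insertion (V : Type*) where
  /-- the letters before `a` -/
  p : List V
  /-- the letter after which `u` is inserted -/
  a : V
  /-- the inserted letter -/
  u : V
  /-- the letters after `u` that are multiples of `u` taken into account by the rule -/
  mid : List V
  /-- the remaining letters -/
  tl : List V
  /-- the rule in force -/
  block : Bool

namespace Insertion

variable {V : Type*} (t : Insertion V)

/-- The word without the inserted letter. -/
def lower : List V := t.p ++ t.a :: (t.mid ++ t.tl)

/-- The word with the inserted letter. -/
def upper : List V := t.p ++ t.a :: t.u :: (t.mid ++ t.tl)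

lemma lower_eq : t.lower = (t.p ++ [t.a] ++ t.mid) ++ t.tl := by simp [lower]

lemma upper_eq : t.upper = (t.p ++ [t.a] ++ t.u :: t.mid) ++ t.tl := by simp [upper]

/-- The rank of an insertion. Filling the words in order of increasing rank, every proper subword
of `upper` other than `lower` is present by the time `upper` is added. -/
def rank : ℕ ×ₗ ℕ ×ₗ ℕ ×ₗ ℕ :=
  toLex (t.tl.length, toLex (t.block.toNat, toLex (t.p.length, t.mid.length)))

end Insertion

namespace ScaledPreorder

variable {V : Type*} (S : ScaledPreorder V)

/-- The rule for words whose first `sim`-class block is not increasing: `a` is the last letter of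
the block that is not an upper bound of its predecessors, and `u` is the least upper bound of the
letters up to `a`, within the class. -/
structure IsBlockInsertion (p : List V) (a u : V) (mid tl : List V) : Prop where
  sim_p : ∀ x ∈ p, S.sim x a
  sim_mid : ∀ x ∈ u :: mid, S.sim x a
  sim_tl : ∀ x ∈ tl.head?, ¬ S.sim x a
  not_le : ∃ x ∈ p, ¬ S.le x a
  lub : ∀ x, S.sim x a → (S.le u x ↔ ∀ y ∈ p ++ [a], S.le y x)
  chain : (u :: mid).Pairwise S.le

/-- The rule for the other words: `p ++ a :: mid` is a maximal increasing initial segment, the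
next letter `b` does not belong to the first block, `mid` consists of the last letters
of the segment that are multiples of `b` and at least `b`, and `u` is the least upper bound of `a`
and `b` in the class of `b`. -/
structure IsBreakInsertion (p : List V) (a u : V) (mid : List V) (b : V) : Prop where
  chain : (p ++ [a] ++ u :: mid).Pairwise S.le
  sim_mid : ∀ x ∈ u :: mid, S.sim x b ∧ S.le b x
  not_mid : ¬ (S.sim a b ∧ S.le b a)
  lub : ∀ x, S.sim x b → (S.le u x ↔ S.le a x ∧ S.le b x)
  break_ : ¬ (p ++ [a] ++ mid ++ [b]).Pairwise S.le
  not_sim : ∃ x ∈ p ++ [a], ¬ S.sim x b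

/-- The insertion follows one of the two rules, and neither word has two equal consecutive
letters. -/
structure IsValid (t : Insertion V) : Prop where
  isBlock : t.block = true → S.IsBlockInsertion t.p t.a t.u t.mid t.tl
  isBreak : t.block = false → ∃ b tl, t.tl = b :: tl ∧ S.IsBreakInsertion t.p t.a t.u t.mid b
  lower_ne : t.lower.IsChain (· ≠ ·)
  upper_ne : t.upper.IsChain (· ≠ ·)

end ScaledPreorder

end ContMonoid

namespace List

variable {V : Type*}

/-- If `l ++ r` is a subword of `l' ++ r'`, where `l' ` satisfies a condition that is inherited
by subwords and violated by `l ++ r.take 1`, then `r` is a subword of `r'`. -/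
lemma exists_of_append_sublist_append {P : List V → Prop}
    (hP : ∀ {m m' : List V}, m.Sublist m' → P m' → P m) {l r l' r' : List V}
    (h : (l ++ r).Sublist (l' ++ r')) (hl' : P l') (hr : ∀ b ∈ r.head?, ¬ P (l ++ [b])) :
    ∃ l₁ m, l = l₁ ++ m ∧ l₁.Sublist l' ∧ (m ++ r).Sublist r' := by
  obtain ⟨s, s', hs, h₁, h₂⟩ := sublist_append_iff.1 h
  obtain ⟨m, rfl, rfl⟩ | ⟨m, rfl, rfl⟩ := append_eq_append_iff.1 hs
  · cases m with
    | nil => exact ⟨l, [], by simp, by simpa using h₁, by simpa using h₂⟩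
    | cons b m =>
      exact (hr b (by simp) (hP (((append_sublist_append_left l).2 (by simp)).trans h₁) hl')).elim
  · exact ⟨s, m, rfl, h₁, h₂⟩

/-- A list that is not pairwise related splits at its last element that is not related to all its
predecessors. -/
lemma exists_last_not_pairwise {R : V → V → Prop} (l : List V) (h : ¬ l.Pairwise R) :
    ∃ p a m, l = p ++ a :: m ∧ (∃ x ∈ p, ¬ R x a) ∧ m.Pairwise R ∧
      ∀ x ∈ p ++ [a], ∀ y ∈ m, R x y := by
  induction l using List.reverseRecOn with
  | nil => simp at h
  | append_singleton l c ih =>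
    by_cases hc : ∀ x ∈ l, R x c
    · have hl : ¬ l.Pairwise R := fun hl => h (by
        rw [pairwise_append]
        simpa using ⟨hl, hc⟩)
      obtain ⟨p, a, m, rfl, h₁, h₂, h₃⟩ := ih hl
      refine ⟨p, a, m ++ [c], by simp, h₁, ?_, ?_⟩
      · rw [pairwise_append]
        exact ⟨h₂, by simp, fun x hx y hy => by
          obtain rfl : y = c := by simpa using hy
          exact hc x (by simp [hx])⟩
      · intro x hx y hy
        obtain hy | hy := mem_append.1 hy
        · exact h₃ x hx y hy
        · obtain rfl : y = c := by simpa using hy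
          exact hc x (by simp only [mem_append, mem_cons, not_mem_nil] at hx ⊢; tauto)
    · push Not at hc
      exact ⟨l, c, [], rfl, hc, by simp, by simp⟩

/-- A list that is not pairwise related has a longest initial segment that is. -/
lemma exists_first_not_pairwise {R : V → V → Prop} (l : List V) (h : ¬ l.Pairwise R) :
    ∃ c b m, l = c ++ b :: m ∧ c.Pairwise R ∧ ¬ (c ++ [b]).Pairwise R := by
  induction l using List.reverseRecOn with
  | nil => simp at h
  | append_singleton l c ih =>
    by_cases hl : l.Pairwise R
    · exact ⟨l, c, [], rfl, hl, h⟩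
    · obtain ⟨d, b, m, rfl, h₁, h₂⟩ := ih hl
      exact ⟨d, b, m ++ [c], by simp, h₁, h₂⟩

/-- A list splits at its last element that violates a given property. -/
lemma exists_last_not {P : V → Prop} (l : List V) (h : ∃ x ∈ l, ¬ P x) :
    ∃ p a m, l = p ++ a :: m ∧ ¬ P a ∧ ∀ x ∈ m, P x := by
  induction l using List.reverseRecOn with
  | nil => simp at h
  | append_singleton l c ih =>
    by_cases hc : P c
    · obtain ⟨x, hx, hxP⟩ := h
      obtain hx | hx := mem_append.1 hx
      · obtain ⟨p, a, m, rfl, h₁, h₂⟩ := ih ⟨x, hx, hxP⟩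
        refine ⟨p, a, m ++ [c], by simp, h₁, fun y hy => ?_⟩
        obtain hy | hy := mem_append.1 hy
        · exact h₂ y hy
        · obtain rfl : y = c := by simpa using hy
          exact hc
      · obtain rfl : x = c := by simpa using hx
        exact (hxP hc).elim
    · exact ⟨l, c, [], rfl, hc, by simp⟩

/-- The longest initial segment whose elements have a property. -/
lemma exists_eq_append_head? (P : V → Prop) (l : List V) :
    ∃ c m, l = c ++ m ∧ (∀ x ∈ c, P x) ∧ ∀ x ∈ m.head?, ¬ P x := by
  induction l with
  | nil => exact ⟨[], [], by simp⟩
  | cons a l ih =>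
    by_cases ha : P a
    · obtain ⟨c, m, rfl, h₁, h₂⟩ := ih
      exact ⟨a :: c, m, rfl, by simpa using ⟨ha, h₁⟩, h₂⟩
    · exact ⟨[], a :: l, rfl, by simp, by simpa using ha⟩

end List

namespace ContMonoid

namespace ScaledPreorder

variable {V : Type*} {S : ScaledPreorder V}

lemma IsBlockInsertion.le_u {p : List V} {a u : V} {mid tl : List V}
    (h : S.IsBlockInsertion p a u mid tl) : ∀ x ∈ p ++ [a], S.le x u :=
  (h.lub u (h.sim_mid u (by simp))).1 (S.le_refl u)

lemma IsBlockInsertion.le_mid {p : List V} {a u : V} {mid tl : List V}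
    (h : S.IsBlockInsertion p a u mid tl) :
    ∀ x ∈ p ++ [a], ∀ y ∈ u :: mid, S.le x y := by
  intro x hx y hy
  obtain rfl | hy := List.mem_cons.1 hy
  · exact h.le_u x hx
  · exact S.le_trans (h.le_u x hx) ((List.pairwise_cons.1 h.chain).1 y hy)

/-- Comparison of two insertions by the same rule when `t.p ++ [t.a]`, with some further letters
`m`, already is a subword of `t'.p ++ [t'.a]`: either `t.p` is shorter than `t'.p`, or `m` is empty
and the letters up to `a` agree. -/
lemma eq_or_rank_lt_aux {t t' : Insertion V} (htl : t.tl = t'.tl)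
    (hb : t.block = t'.block) {m : List V} (hp : (t.p ++ [t.a] ++ m).Sublist (t'.p ++ [t'.a]))
    {n : List V} (hn : t.mid = m ++ n) (hmid : n.Sublist (t'.u :: t'.mid))
    (hu : t.p = t'.p → t.a = t'.a → t.u = t'.u)
    (hne : t.upper.IsChain (· ≠ ·)) : t = t' ∨ t.rank < t'.rank := by
  have hlen := hp.length_le
  simp only [List.length_append, List.length_cons, List.length_nil] at hlen
  by_cases hlt : t.p.length < t'.p.length
  · right
    simp [Insertion.rank, Prod.Lex.lt_iff, htl, hb, hlt]
  obtain rfl : m = [] := List.eq_nil_of_length_eq_zero (by omega)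
  rw [List.append_nil] at hp
  have hpa := hp.eq_of_length_le (by simp; omega)
  obtain ⟨hp', ha'⟩ := List.append_inj' hpa rfl
  obtain rfl : n = t.mid := by simpa using hn.symm
  have hu' := hu hp' (by simpa using ha')
  have hsub : t.mid.Sublist t'.mid := by
    cases h' : t.mid with
    | nil => simp
    | cons x l =>
      rw [h'] at hmid
      rcases hmid with _ | h | h
      · assumption
      · simp only [Insertion.upper, h', List.isChain_append, List.cons_append,
          List.isChain_cons_cons] at hne
        exact (hne.2.1.2.1 hu').elim
  obtain h | h := hsub.length_le.eq_or_lt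
  · left
    ext1
    · exact hp'
    · simpa using ha'
    · exact hu'
    · exact hsub.eq_of_length h
    · exact htl
    · exact hb
  · right
    simp [Insertion.rank, Prod.Lex.lt_iff, htl, hb, hp', h]

/-- Comparison of two insertions by the same rule, with the same letters after `mid`. -/
lemma eq_or_rank_lt_of_sublist {t t' : Insertion V} (htl : t.tl = t'.tl)
    (hb : t.block = t'.block)
    (hsub : (t.p ++ [t.a] ++ t.mid).Sublist (t'.p ++ [t'.a] ++ t'.u :: t'.mid))
    (ha : ∀ s m : List V, t.p = s ++ m → s.Sublist (t'.p ++ [t'.a]) →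
      ¬ (m ++ [t.a]).Sublist (t'.u :: t'.mid))
    (hu : t.p = t'.p → t.a = t'.a → t.u = t'.u)
    (hne : t.upper.IsChain (· ≠ ·)) : t = t' ∨ t.rank < t'.rank := by
  obtain ⟨s, s', hs, h₁, h₂⟩ := List.sublist_append_iff.1 hsub
  obtain ⟨m, rfl, hm⟩ | ⟨m, hm, rfl⟩ := List.append_eq_append_iff.1 hs
  · exact eq_or_rank_lt_aux htl hb h₁ hm h₂ hu hne
  · obtain rfl | ⟨m, x, rfl⟩ := m.eq_nil_or_concat'
    · exact eq_or_rank_lt_aux (m := []) htl hb (by simpa [hm] using h₁) rfl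
        (by simpa using h₂) hu hne
    · rw [← List.append_assoc] at hm
      obtain ⟨hm₁, hm₂⟩ := List.append_inj' hm rfl
      obtain rfl : t.a = x := by simpa using hm₂
      exact (ha s m hm₁ h₁ ((List.sublist_append_left _ _).trans h₂)).elim

/-- The key property of the two rules: a word to which a letter should be inserted and which is a
subword of `t'.upper` either is `t'.lower`, or has smaller rank. -/
theorem IsValid.eq_or_rank_lt {t t' : Insertion V} (h : S.IsValid t) (h' : S.IsValid t')
    (hsub : t.lower.Sublist t'.upper) : t = t' ∨ t.rank < t'.rank := by
  rw [Insertion.lower_eq, Insertion.upper_eq] at hsub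
  cases hb : t.block <;> cases hb' : t'.block
  -- In each case, the initial segment of `t'` governed by its rule cannot absorb the first letter
  -- of `t.tl`, so `t.tl` is a subword of `t'.tl`; the later entries of the rank decide on equality.
  · obtain ⟨b, tl, htl, H⟩ := h.isBreak hb
    obtain ⟨b', tl', htl', H'⟩ := h'.isBreak hb'
    obtain ⟨s, m, hs, h₁, h₂⟩ := List.exists_of_append_sublist_append
      (P := fun l => l.Pairwise S.le) (fun h => List.Pairwise.sublist h) hsub H'.chain
      (by simpa [htl] using H.break_)
    have hlen := h₂.length_le
    rw [List.length_append] at hlen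
    by_cases hlt : t.tl.length < t'.tl.length
    · right
      simp [Insertion.rank, Prod.Lex.lt_iff, hlt]
    obtain rfl : m = [] := List.eq_nil_of_length_eq_zero (by omega)
    have htt : t.tl = t'.tl := h₂.eq_of_length_le (by simp; omega)
    rw [List.append_nil] at hs
    subst hs
    obtain ⟨rfl, rfl⟩ : b = b' ∧ tl = tl' := by simpa [htl, htl'] using htt
    refine eq_or_rank_lt_of_sublist htt (hb.trans hb'.symm) h₁ (fun s m _ _ hm => ?_)
      (fun _ ha => ?_) h.upper_ne
    · exact H.not_mid (H'.sim_mid _ (hm.subset (by simp)))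
    · have h1 := (H.sim_mid t.u (by simp)).1
      have h2 := (H'.sim_mid t'.u (by simp)).1
      refine S.antisymm (S.sim_trans h1 (S.sim_symm h2)) ((H.lub _ h2).2 ?_) ((H'.lub _ h1).2 ?_)
      · rw [ha]; exact (H'.lub _ h2).1 (S.le_refl _)
      · rw [← ha]; exact (H.lub _ h1).1 (S.le_refl _)
  · obtain ⟨b, tl, htl, H⟩ := h.isBreak hb
    have H' := h'.isBlock hb'
    obtain ⟨s, m, hs, h₁, h₂⟩ := List.exists_of_append_sublist_append
      (P := fun l => ∀ x ∈ l, ∀ y ∈ l, S.sim x y)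
      (fun h hm x hx y hy => hm x (h.subset hx) y (h.subset hy)) hsub
      (by
        have : ∀ x ∈ t'.p ++ [t'.a] ++ t'.u :: t'.mid, S.sim x t'.a := by
          intro x hx
          rw [List.mem_append, List.mem_append, List.mem_singleton] at hx
          obtain (hx | rfl) | hx := hx
          exacts [H'.sim_p x hx, S.sim_refl _, H'.sim_mid x hx]
        exact fun x hx y hy => S.sim_trans (this x hx) (S.sim_symm (this y hy)))
      (by
        intro c hc hh
        obtain rfl : b = c := by simpa [htl] using hc
        obtain ⟨x, hx, hxb⟩ := H.not_sim
        exact hxb (hh x (by simp only [List.mem_append] at hx ⊢; tauto) b (by simp)))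
    have hlen := h₂.length_le
    rw [List.length_append] at hlen
    right
    obtain hlt | heq := (show t.tl.length ≤ t'.tl.length by omega).lt_or_eq
    · simp [Insertion.rank, Prod.Lex.lt_iff, hlt]
    · simp [Insertion.rank, Prod.Lex.lt_iff, heq, hb, hb']
  · have H := h.isBlock hb
    obtain ⟨b', tl', htl', H'⟩ := h'.isBreak hb'
    obtain ⟨x, hx, hxa⟩ := H.not_le
    -- The letter `a` ends an initial segment that is not increasing, so it comes after the break.
    rw [show t.p ++ [t.a] ++ t.mid ++ t.tl = t.p ++ (t.a :: t.mid ++ t.tl) by simp] at hsub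
    obtain ⟨s, m, hs, h₁, h₂⟩ := List.exists_of_append_sublist_append
      (P := fun l => l.Pairwise S.le) (fun h => List.Pairwise.sublist h) hsub H'.chain
      (by
        intro c hc hh
        obtain rfl : t.a = c := by simpa using hc
        exact hxa ((List.pairwise_append.1 hh).2.2 x hx _ (by simp)))
    have hlen := h₂.length_le
    simp only [List.length_append, List.length_cons] at hlen
    right
    simp [Insertion.rank, Prod.Lex.lt_iff, show t.tl.length < t'.tl.length by omega]
  · have H := h.isBlock hb
    have H' := h'.isBlock hb'
    have hsim : ∀ x ∈ t.p ++ [t.a] ++ t.mid, S.sim x t.a := by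
      intro x hx
      rw [List.mem_append, List.mem_append, List.mem_singleton] at hx
      obtain (hx | rfl) | hx := hx
      exacts [H.sim_p x hx, S.sim_refl _, H.sim_mid x (by simp [hx])]
    have hsim' : ∀ x ∈ t'.p ++ [t'.a] ++ t'.u :: t'.mid, S.sim x t'.a := by
      intro x hx
      rw [List.mem_append, List.mem_append, List.mem_singleton] at hx
      obtain (hx | rfl) | hx := hx
      exacts [H'.sim_p x hx, S.sim_refl _, H'.sim_mid x hx]
    obtain ⟨s, m, hs, h₁, h₂⟩ := List.exists_of_append_sublist_append
      (P := fun l => ∀ x ∈ l, ∀ y ∈ l, S.sim x y)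
      (fun h hm x hx y hy => hm x (h.subset hx) y (h.subset hy)) hsub
      (fun x hx y hy => S.sim_trans (hsim' x hx) (S.sim_symm (hsim' y hy)))
      (fun c hc hh => H.sim_tl c hc (hh c (by simp) t.a (by simp)))
    have hlen := h₂.length_le
    rw [List.length_append] at hlen
    by_cases hlt : t.tl.length < t'.tl.length
    · right
      simp [Insertion.rank, Prod.Lex.lt_iff, hlt]
    obtain rfl : m = [] := List.eq_nil_of_length_eq_zero (by omega)
    have htt : t.tl = t'.tl := h₂.eq_of_length_le (by simp; omega)
    rw [List.append_nil] at hs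
    subst hs
    refine eq_or_rank_lt_of_sublist htt (hb.trans hb'.symm) h₁ (fun s m hp hs hm => ?_)
      (fun hp ha => ?_) h.upper_ne
    · obtain ⟨x, hx, hxa⟩ := H.not_le
      rw [hp, List.mem_append] at hx
      obtain hx | hx := hx
      · exact hxa (H'.le_mid x (hs.subset hx) _ (hm.subset (by simp)))
      · exact hxa ((List.pairwise_append.1 (H'.chain.sublist hm)).2.2 x hx _ (by simp))
    · have h1 := H.sim_mid t.u (by simp)
      have h2 := H'.sim_mid t'.u (by simp)
      rw [← ha] at h2
      refine S.antisymm (S.sim_trans h1 (S.sim_symm h2)) ((H.lub _ h2).2 ?_)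
        ((H'.lub _ (ha ▸ h1)).2 ?_)
      · rw [ha, hp]; exact H'.le_u
      · rw [← ha, ← hp]; exact H.le_u

variable (S) in
lemma exists_lub_list (l : List V) (a : V) :
    ∃ u, S.sim u a ∧ ∀ x, S.sim x a → (S.le u x ↔ ∀ y ∈ l ++ [a], S.le y x) := by
  induction l with
  | nil => exact ⟨a, S.sim_refl a, by simp⟩
  | cons b l ih =>
    obtain ⟨u, hu, h⟩ := ih
    obtain ⟨v, hv, h'⟩ := S.exists_lub b u
    refine ⟨v, S.sim_trans hv hu, fun x hx => ?_⟩
    rw [h' x (S.sim_trans hx (S.sim_symm hu)), h x hx]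
    simp

lemma IsValid.not_pairwise_lower {t : Insertion V} (h : S.IsValid t) :
    ¬ t.lower.Pairwise S.le := by
  intro hl
  cases hb : t.block
  · obtain ⟨b, tl, htl, H⟩ := h.isBreak hb
    refine H.break_ (hl.sublist ?_)
    rw [Insertion.lower_eq, htl]
    simp
  · obtain ⟨x, hx, hxa⟩ := (h.isBlock hb).not_le
    exact hxa ((List.pairwise_append.1 hl).2.2 x hx _ (by simp))

/-- If all letters of the lower word are multiples of each other, the rule is that of blocks, and
the inserted letter is a multiple of them as well. -/
lemma IsValid.sim_upper {t : Insertion V} (h : S.IsValid t)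
    (hl : ∀ x ∈ t.lower, S.sim x t.a) : ∀ x ∈ t.upper, S.sim x t.a := by
  cases hb : t.block
  · obtain ⟨b, tl, htl, H⟩ := h.isBreak hb
    obtain ⟨x, hx, hxb⟩ := H.not_sim
    refine (hxb (S.sim_trans (hl x ?_) (S.sim_symm (hl b ?_)))).elim
    · simp only [Insertion.lower_eq, List.mem_append] at hx ⊢
      tauto
    · simp [Insertion.lower, htl]
  · have := (h.isBlock hb).sim_mid t.u (by simp)
    intro x hx
    simp only [Insertion.upper, Insertion.lower, List.mem_append, List.mem_cons] at hx hl
    obtain hx | rfl | rfl | hx := hx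
    exacts [hl x (Or.inl hx), S.sim_refl _, this, hl x (Or.inr (Or.inr hx))]

/-- If nothing comes after the inserted letter, then all letters are multiples of each other. -/
lemma IsValid.sim_lower_of_eq_nil {t : Insertion V} (h : S.IsValid t)
    (ht : t.mid ++ t.tl = []) : ∀ x ∈ t.lower, S.sim x t.a := by
  obtain ⟨hmid, htl⟩ := List.append_eq_nil_iff.1 ht
  cases hb : t.block
  · obtain ⟨b, tl, htl', -⟩ := h.isBreak hb
    simp [htl] at htl'
  · intro x hx
    simp only [Insertion.lower, hmid, htl, List.mem_append, List.mem_cons, List.append_nil,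
      List.not_mem_nil, or_false] at hx
    obtain hx | rfl := hx
    exacts [(h.isBlock hb).sim_p x hx, S.sim_refl _]

/-- A block insertion always has something before `a`, a break insertion something after `mid`. -/
lemma IsValid.p_or_tl_ne_nil {t : Insertion V} (h : S.IsValid t) :
    t.p ≠ [] ∨ t.mid ++ t.tl ≠ [] := by
  cases hb : t.block
  · obtain ⟨b, tl, htl, -⟩ := h.isBreak hb
    simp [htl]
  · obtain ⟨x, hx, -⟩ := (h.isBlock hb).not_le
    exact Or.inl (List.ne_nil_of_mem hx)

/-- The condition on equal consecutive letters needs to be checked for only one of the two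
words, if `u` differs from the letter that follows it. -/
lemma IsBlockInsertion.exists_isValid {p mid tl : List V} {a u : V}
    (h : S.IsBlockInsertion p a u mid tl)
    (hw : (p ++ a :: (mid ++ tl)).IsChain (· ≠ ·) ∧ (∀ x ∈ mid.head?, u ≠ x) ∨
      (p ++ a :: u :: (mid ++ tl)).IsChain (· ≠ ·)) : S.IsValid ⟨p, a, u, mid, tl, true⟩ := by
  have hau : ∀ y ∈ u :: mid, a ≠ y := by
    rintro y hy rfl
    obtain ⟨x, hx, hxa⟩ := h.not_le
    exact hxa (h.le_mid x (by simp [hx]) _ hy)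
  have htl : ∀ y ∈ u :: mid ++ [a], ∀ x ∈ tl.head?, y ≠ x := by
    rintro y hy x hx rfl
    refine h.sim_tl y hx ?_
    obtain hy | hy := List.mem_append.1 hy
    · exact h.sim_mid y hy
    · rw [List.mem_singleton.1 hy]; exact S.sim_refl _
  refine ⟨fun _ => h, by simp, ?_, ?_⟩
  · obtain hw | hw := hw
    · exact hw.1
    · simp only [Insertion.lower]
      rw [List.isChain_append] at hw ⊢
      refine ⟨hw.1, ?_, by simpa using hw.2.2⟩
      have h2 := (List.isChain_cons_cons.1 hw.2.1).2
      rw [List.isChain_cons] at h2 ⊢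
      refine ⟨fun x hx => ?_, h2.2⟩
      cases mid with
      | nil => exact htl a (by simp) x (by simpa using hx)
      | cons y mid =>
        obtain rfl : y = x := by simpa using hx
        exact hau y (by simp)
  · obtain hw | hw := hw
    · simp only [Insertion.upper]
      obtain ⟨hw, hu⟩ := hw
      rw [List.isChain_append] at hw ⊢
      refine ⟨hw.1, ?_, by simpa using hw.2.2⟩
      rw [List.isChain_cons_cons]
      refine ⟨hau u (by simp), ?_⟩
      have h2 := hw.2.1
      rw [List.isChain_cons] at h2 ⊢
      refine ⟨fun x hx => ?_, h2.2⟩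
      cases mid with
      | nil => exact htl u (by simp) x (by simpa using hx)
      | cons y mid => exact hu x (by simpa using hx)
    · exact hw

/-- The analogue of `IsBlockInsertion.exists_isValid` for the other rule. -/
lemma IsBreakInsertion.exists_isValid {p mid tl : List V} {a u b : V}
    (h : S.IsBreakInsertion p a u mid b)
    (hw : (p ++ a :: (mid ++ b :: tl)).IsChain (· ≠ ·) ∧ (∀ x ∈ mid.head?, u ≠ x) ∨
      (p ++ a :: u :: (mid ++ b :: tl)).IsChain (· ≠ ·)) :
    S.IsValid ⟨p, a, u, mid, b :: tl, false⟩ := by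
  have hab : ∀ y, S.sim y b ∧ S.le b y → a ≠ y := by
    rintro y hy rfl
    exact h.not_mid hy
  refine ⟨by simp, fun _ => ⟨b, tl, rfl, h⟩, ?_, ?_⟩
  · obtain hw | hw := hw
    · exact hw.1
    · simp only [Insertion.lower]
      rw [List.isChain_append] at hw ⊢
      refine ⟨hw.1, ?_, by simpa using hw.2.2⟩
      have h2 := (List.isChain_cons_cons.1 hw.2.1).2
      rw [List.isChain_cons] at h2 ⊢
      refine ⟨fun x hx => hab x ?_, h2.2⟩
      cases mid with
      | nil =>
        obtain rfl : b = x := by simpa using hx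
        exact ⟨S.sim_refl _, S.le_refl _⟩
      | cons y mid =>
        obtain rfl : y = x := by simpa using hx
        exact h.sim_mid y (by simp)
  · obtain hw | hw := hw
    · simp only [Insertion.upper]
      obtain ⟨hw, hu⟩ := hw
      rw [List.isChain_append] at hw ⊢
      refine ⟨hw.1, ?_, by simpa using hw.2.2⟩
      rw [List.isChain_cons_cons]
      refine ⟨hab u (h.sim_mid u (by simp)), ?_⟩
      have h2 := hw.2.1
      rw [List.isChain_cons] at h2 ⊢
      refine ⟨fun x hx => ?_, h2.2⟩
      cases mid with
      | nil =>
        -- If `u` were equal to `b`, then `a` would be at most `b` and there would be no break.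
        obtain rfl : b = x := by simpa using hx
        rintro rfl
        exact h.break_ (h.chain.sublist (by simp))
      | cons y mid => exact hu x (by simpa using hx)
    · exact hw

/-- Every word without equal consecutive letters that is not increasing belongs to an insertion. -/
theorem exists_isValid {w : List V} (hw : w.IsChain (· ≠ ·)) (h : ¬ w.Pairwise S.le) :
    ∃ t, S.IsValid t ∧ (w = t.lower ∨ w = t.upper) := by
  cases w with
  | nil => simp at h
  | cons z w' =>
  -- The first block `β` of multiples of `z` decides on the rule. Each rule determines `p`, `a` and
  -- the letter `u` to insert: the word is `upper` if `u` is already there, and `lower` otherwise.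
  obtain ⟨β, tl, hβ, hz, htl⟩ := List.exists_eq_append_head? (fun x => S.sim x z) (z :: w')
  by_cases hc : β.Pairwise S.le
  · obtain ⟨c, b, m, hm, hc', hb⟩ := List.exists_first_not_pairwise _ h
    have hns : ∃ x ∈ c, ¬ S.sim x b := by
      by_contra! hs
      have hcne : c ≠ [] := by rintro rfl; simp at hb
      obtain ⟨y, c, rfl⟩ := List.exists_cons_of_ne_nil hcne
      obtain rfl : z = y := by simpa using congrArg List.head? hm
      have hbz : ∀ x ∈ z :: c ++ [b], S.sim x z := by
        intro x hx
        have h1 := S.sim_symm (hs z (by simp))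
        obtain hx | hx := List.mem_append.1 hx
        · exact S.sim_trans (hs x hx) h1
        · rwa [List.mem_singleton.1 hx]
      have hm' : β ++ tl = (z :: c ++ [b]) ++ m := by rw [← hβ, hm]; simp
      obtain ⟨d, hd, -⟩ | ⟨d, hd, hd'⟩ := List.append_eq_append_iff.1 hm'
      · cases d with
        | nil => exact hb (by rw [hd]; simpa using hc)
        | cons e d =>
          have he : e ∈ tl.head? := by simp_all
          exact htl e he (hbz e (by rw [hd]; simp))
      · exact hb (hc.sublist (by rw [hd]; simp))
    obtain ⟨p, a, mid, rfl, ha, hmid⟩ :=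
      List.exists_last_not (P := fun x => S.sim x b ∧ S.le b x) c
        (by obtain ⟨x, hx, hxb⟩ := hns; exact ⟨x, hx, fun h => hxb h.1⟩)
    obtain ⟨u, hub, hu⟩ := S.exists_lub a b
    have hu' := (hu u hub).1 (S.le_refl u)
    have hpw := List.pairwise_append.1 hc'
    have hpw' := List.pairwise_cons.1 hpw.2.1
    have humid : ∀ y ∈ mid, S.le u y := fun y hy =>
      (hu y (hmid y hy).1).2 ⟨hpw'.1 y hy, (hmid y hy).2⟩
    have hpu : ∀ x ∈ p ++ [a], S.le x u := by
      intro x hx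
      obtain hx | hx := List.mem_append.1 hx
      · exact S.le_trans (hpw.2.2 x hx a (by simp)) hu'.1
      · rw [List.mem_singleton.1 hx]; exact hu'.1
    have hchain : ∀ mid' : List V, mid'.Sublist mid → (p ++ [a] ++ u :: mid').Pairwise S.le := by
      intro mid' hs
      rw [List.pairwise_append, List.pairwise_cons]
      refine ⟨hc'.sublist (by simp), ⟨fun y hy => humid y (hs.subset hy), hpw'.2.sublist hs⟩, ?_⟩
      intro x hx y hy
      obtain rfl | hy := List.mem_cons.1 hy
      · exact hpu x hx
      · exact S.le_trans (hpu x hx) (humid y (hs.subset hy))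
    have hns' : ∃ x ∈ p ++ [a], ¬ S.sim x b := by
      obtain ⟨x, hx, hxb⟩ := hns
      refine ⟨x, ?_, hxb⟩
      simp only [List.mem_append, List.mem_cons, List.not_mem_nil, or_false] at hx ⊢
      obtain hx | hx | hx := hx
      exacts [Or.inl hx, Or.inr hx, (hxb (hmid x hx).1).elim]
    rw [hm] at hw ⊢
    by_cases hh : ∃ mid', mid = u :: mid'
    · obtain ⟨mid', rfl⟩ := hh
      refine ⟨⟨p, a, u, mid', b :: m, false⟩, IsBreakInsertion.exists_isValid
        ⟨hchain mid' (by simp), fun x hx => hmid x hx, ha, hu, fun hb' => hb ?_, hns'⟩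
          (Or.inr (by simpa using hw)), Or.inr (by simp [Insertion.upper])⟩
      -- Without `u` there still is a break, since otherwise `a ≤ b` and hence `u ≤ b`.
      have hab : S.le a b := (List.pairwise_append.1 hb').2.2 a (by simp) b (by simp)
      have hub' : S.le u b := (hu b (S.sim_refl b)).2 ⟨hab, S.le_refl b⟩
      rw [List.pairwise_append]
      refine ⟨hc', by simp, fun x hx y hy => ?_⟩
      obtain rfl := List.mem_singleton.1 hy
      simp only [List.mem_append, List.mem_cons] at hx
      obtain hx | rfl | rfl | hx := hx
      · exact S.le_trans (hpu x (by simp [hx])) hub'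
      · exact hab
      · exact hub'
      · exact (List.pairwise_append.1 hb').2.2 x (by simp [hx]) _ (by simp)
    · refine ⟨⟨p, a, u, mid, b :: m, false⟩, IsBreakInsertion.exists_isValid
        ⟨hchain mid (by simp), ?_, ha, hu, by simpa using hb, hns'⟩
          (Or.inl ⟨by simpa using hw, ?_⟩), Or.inl (by simp [Insertion.lower])⟩
      · intro x hx
        obtain rfl | hx := List.mem_cons.1 hx
        · exact ⟨hub, hu'.2⟩
        · exact hmid x hx
      · rintro x hx rfl
        cases mid with
        | nil => simp at hx
        | cons y mid =>
          obtain rfl : y = u := by simpa using hx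
          exact hh ⟨mid, rfl⟩
  · obtain ⟨p, a, mid, rfl, hpa, hmid, hle⟩ := List.exists_last_not_pairwise _ hc
    have haz := hz a (by simp)
    have hsim : ∀ x ∈ p ++ a :: mid, S.sim x a := fun x hx => S.sim_trans (hz x hx) (S.sim_symm haz)
    obtain ⟨u, hua, hu⟩ := S.exists_lub_list p a
    have hchain : ∀ mid' : List V, mid'.Sublist mid → (u :: mid').Pairwise S.le := by
      intro mid' hs
      rw [List.pairwise_cons]
      refine ⟨fun y hy => (hu y (hsim y ?_)).2 fun x hx => hle x hx y (hs.subset hy),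
        hmid.sublist hs⟩
      simp [hs.subset hy]
    have htl' : ∀ x ∈ tl.head?, ¬ S.sim x a := fun x hx h => htl x hx (S.sim_trans h haz)
    rw [hβ] at hw ⊢
    by_cases hh : ∃ mid', mid = u :: mid'
    · obtain ⟨mid', rfl⟩ := hh
      exact ⟨⟨p, a, u, mid', tl, true⟩, IsBlockInsertion.exists_isValid
        ⟨fun x hx => hsim x (by simp [hx]), fun x hx => hsim x (by
          simp only [List.mem_append, List.mem_cons] at hx ⊢; tauto), htl', hpa, hu,
          hchain mid' (by simp)⟩
        (Or.inr (by simpa using hw)), Or.inr (by simp [Insertion.upper])⟩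
    · refine ⟨⟨p, a, u, mid, tl, true⟩, IsBlockInsertion.exists_isValid
        ⟨fun x hx => hsim x (by simp [hx]), fun x hx => ?_, htl', hpa, hu, hchain mid (by simp)⟩
        (Or.inl ⟨by simpa using hw, ?_⟩), Or.inl (by simp [Insertion.lower])⟩
      · obtain rfl | hx := List.mem_cons.1 hx
        · exact hua
        · exact hsim x (by simp [hx])
      · rintro x hx rfl
        cases mid with
        | nil => simp at hx
        | cons y mid =>
          obtain rfl : y = u := by simpa using hx
          exact hh ⟨mid, rfl⟩

end ScaledPreorder
end ContMonoid

namespace ContMonoid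

open SSet

/-! ### Words as simplices of the bar construction of a group -/

section Words

variable {G : Type} [Group G] {n m : ℕ}

/-- The simplex of the bar construction of a group given by a word `f`: the arrow from `i` to `j`
is `f j * (f i)⁻¹`. Two words give the same simplex if they differ by a right translation. -/
def wordSimplex (f : Fin (n + 1) → G) : (bar G) _⦋n⦌ :=
  show Fin (n + 1) ⥤ SingleObj G from
  { obj := fun _ => SingleObj.star G
    map := fun {i j} _ => f j * (f i)⁻¹
    map_id := fun i => mul_inv_cancel (f i)
    map_comp := fun {i j k} _ _ => by
      change _ = (f k * (f j)⁻¹) * (f j * (f i)⁻¹)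
      group }

/-- The arrow between two vertices of a simplex of the bar construction. -/
def arrow {M : Type} [Monoid M] (x : (bar M) _⦋n⦌) {i j : Fin (n + 1)} (h : i ≤ j) : M :=
  (show Fin (n + 1) ⥤ SingleObj M from x).map (homOfLE h)

lemma arrow_wordSimplex (f : Fin (n + 1) → G) {i j : Fin (n + 1)} (h : i ≤ j) :
    arrow (wordSimplex f) h = f j * (f i)⁻¹ := rfl

lemma arrow_self {M : Type} [Monoid M] (x : (bar M) _⦋n⦌) (i : Fin (n + 1)) :
    arrow x (le_refl i) = 1 :=
  (show Fin (n + 1) ⥤ SingleObj M from x).map_id i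

lemma arrow_comp {M : Type} [Monoid M] (x : (bar M) _⦋n⦌) {i j k : Fin (n + 1)} (h : i ≤ j)
    (h' : j ≤ k) : arrow x h' * arrow x h = arrow x (h.trans h') :=
  ((show Fin (n + 1) ⥤ SingleObj M from x).map_comp (homOfLE h) (homOfLE h')).symm

lemma bar_ext {M : Type} [Monoid M] {x y : (bar M) _⦋n⦌}
    (h : ∀ (i j : Fin (n + 1)) (hij : i ≤ j), arrow x hij = arrow y hij) : x = y := by
  refine CategoryTheory.Functor.ext (F := (show Fin (n + 1) ⥤ SingleObj M from x))
    (G := (show Fin (n + 1) ⥤ SingleObj M from y)) (fun _ => rfl) fun i j f => ?_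
  exact (h i j (leOfHom f)).trans (by simp; rfl)

lemma wordSimplex_eq_iff {f g : Fin (n + 1) → G} :
    wordSimplex f = wordSimplex g ↔ ∃ c, ∀ i, g i = f i * c := by
  constructor
  · intro h
    refine ⟨(f 0)⁻¹ * g 0, fun i => ?_⟩
    have := congrArg (fun x => arrow x (Fin.zero_le i)) h
    simp only [arrow_wordSimplex] at this
    rw [← mul_assoc, this]
    group
  · rintro ⟨c, hc⟩
    refine bar_ext fun i j hij => ?_
    rw [arrow_wordSimplex, arrow_wordSimplex, hc, hc]
    group

lemma exists_eq_wordSimplex (x : (bar G) _⦋n⦌) :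
    ∃ f : Fin (n + 1) → G, f 0 = 1 ∧ x = wordSimplex f := by
  refine ⟨fun i => arrow x (Fin.zero_le i), arrow_self x 0, bar_ext fun i j hij => ?_⟩
  rw [arrow_wordSimplex, ← arrow_comp x (Fin.zero_le i) hij, mul_inv_cancel_right]

lemma δ_wordSimplex (f : Fin (n + 2) → G) (i : Fin (n + 2)) :
    (bar G).δ i (wordSimplex f) = wordSimplex (fun j => f (i.succAbove j)) := rfl

lemma σ_wordSimplex (f : Fin (n + 1) → G) (i : Fin (n + 1)) :
    (bar G).σ i (wordSimplex f) = wordSimplex (fun j => f (i.predAbove j)) := rfl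

/-- A word is nondegenerate if and only if it has no equal consecutive letters. -/
lemma wordSimplex_mem_nonDegenerate {f : Fin (n + 1) → G} :
    wordSimplex f ∈ (bar G).nonDegenerate n ↔
      ∀ i, ∀ h : i + 1 < n + 1, f ⟨i, by omega⟩ ≠ f ⟨i + 1, h⟩ := by
  obtain _ | n := n
  · simp only [SSet.nondegenerate_zero, Set.mem_univ, true_iff]
    omega
  rw [← not_iff_not, ← SSet.mem_degenerate_iff_notMem_nonDegenerate,
    SSet.degenerate_eq_iUnion_range_σ, Set.mem_iUnion]
  push Not
  constructor
  · rintro ⟨i, y, hy⟩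
    obtain ⟨g, -, rfl⟩ := exists_eq_wordSimplex y
    rw [σ_wordSimplex, wordSimplex_eq_iff] at hy
    obtain ⟨c, hc⟩ := hy
    refine ⟨i, by omega, ?_⟩
    have h₁ := hc i.castSucc
    have h₂ := hc i.succ
    rw [Fin.predAbove_castSucc_self] at h₁
    rw [Fin.predAbove_succ_self] at h₂
    exact h₁.trans h₂.symm
  · rintro ⟨i, hi, h⟩
    let k : Fin (n + 1) := ⟨i, by omega⟩
    refine ⟨k, wordSimplex (fun j => f (k.castSucc.succAbove j)), ?_⟩
    rw [σ_wordSimplex]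
    congr 1
    funext j
    by_cases h₁ : k.castSucc < j
    · rw [Fin.predAbove_of_castSucc_lt _ _ h₁]
      obtain ⟨j, rfl⟩ := Fin.eq_succ_of_ne_zero (Fin.ne_zero_of_lt h₁)
      rw [Fin.pred_succ, Fin.succAbove_of_le_castSucc _ _ (Fin.le_castSucc_iff.2 h₁)]
    · rw [Fin.predAbove_of_le_castSucc _ _ (not_lt.1 h₁)]
      obtain h₂ | rfl := (not_lt.1 h₁).lt_or_eq
      · rw [Fin.succAbove_of_castSucc_lt _ _ (by simpa using h₂), Fin.castSucc_castPred]
      · rw [Fin.castPred_castSucc, Fin.succAbove_castSucc_self]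
        exact h.symm

/-- The simplex of the bar construction given by a word, written as a list. -/
def listSimplex (w : List G) (hw : w.length = n + 1) : (bar G) _⦋n⦌ :=
  wordSimplex fun i => w.get (i.cast hw.symm)

lemma exists_eq_listSimplex (x : (bar G).S) :
    ∃ (w : List G) (n : ℕ) (hw : w.length = n + 1), w.head? = some 1 ∧
      x = S.mk (listSimplex w hw) := by
  obtain ⟨n, x, rfl⟩ := x.mk_surjective
  obtain ⟨f, hf, rfl⟩ := exists_eq_wordSimplex x
  refine ⟨List.ofFn f, n, by simp, by simp [List.ofFn_succ, hf], ?_⟩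
  congr
  funext i
  exact (List.getElem_ofFn (by simpa using i.isLt)).symm

lemma listSimplex_mem_nonDegenerate {w : List G} (hw : w.length = n + 1) :
    listSimplex w hw ∈ (bar G).nonDegenerate n ↔ w.IsChain (· ≠ ·) := by
  rw [listSimplex, wordSimplex_mem_nonDegenerate, List.isChain_iff_getElem]
  simp [hw]

/-- A nondegenerate face of a word is a subword, up to right translation. -/
lemma listSimplex_le {w : List G} {w' : List G} (hw : w.length = n + 1) (hw' : w'.length = m + 1)
    (hnd : w.IsChain (· ≠ ·))
    (h : S.mk (listSimplex w hw) ≤ S.mk (listSimplex w' hw')) :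
    ∃ c, (w.map (· * c)).Sublist w' := by
  obtain ⟨φ, hφ⟩ := S.le_iff.1 h
  have hφm : Mono φ := SSet.mono_of_nonDegenerate (X := bar G)
    ⟨listSimplex w hw, (listSimplex_mem_nonDegenerate hw).2 hnd⟩ φ _ hφ
  have hmono : StrictMono φ.toOrderHom :=
    φ.toOrderHom.monotone.strictMono_of_injective (SimplexCategory.mono_iff_injective.1 hφm)
  obtain ⟨c, hc⟩ := wordSimplex_eq_iff.1 hφ.symm
  refine ⟨c, List.sublist_iff_exists_fin_orderEmbedding_get_eq.2 ⟨OrderEmbedding.ofStrictMono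
    (fun i => (φ.toOrderHom (i.cast (by simp [hw]))).cast hw'.symm) fun i j hij => ?_, fun i => ?_⟩⟩
  · exact hmono (Fin.lt_def.2 hij)
  · have := hc (i.cast (by simp [hw]))
    simp only [List.get_eq_getElem, List.getElem_map]
    exact this.symm

lemma listSimplex_eq {w : List G} {w' : List G} (hw : w.length = n + 1) (hw' : w'.length = m + 1)
    (h : S.mk (listSimplex w hw) = S.mk (listSimplex w' hw')) :
    ∃ c, w' = w.map (· * c) := by
  obtain rfl := S.dim_eq_of_mk_eq h
  rw [S.ext_iff, listSimplex, listSimplex, wordSimplex_eq_iff] at h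
  obtain ⟨c, hc⟩ := h
  refine ⟨c, List.ext_get (by simp [hw, hw']) fun i h₁ h₂ => ?_⟩
  have := hc ⟨i, by omega⟩
  simpa using this

lemma δ_listSimplex {w w' : List G} (hw : w.length = n + 2) (hw' : w'.length = n + 1)
    (i : Fin (n + 2)) (h : w' = w.eraseIdx i) :
    (bar G).δ i (listSimplex w hw) = listSimplex w' hw' := by
  subst h
  rw [listSimplex, δ_wordSimplex, listSimplex]
  congr 1
  funext j
  simp only [List.get_eq_getElem, Fin.val_cast, List.getElem_eraseIdx]
  split_ifs with h
  · congr 1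
    rw [Fin.succAbove_of_castSucc_lt _ _ (by simpa [Fin.lt_def] using h)]
    simp
  · congr 1
    rw [Fin.succAbove_of_le_castSucc _ _ (by simpa [Fin.le_def] using h)]
    simp

lemma mem_range_barMap {M N : Type} [Monoid M] [Monoid N] {φ : M →* N}
    (hφ : Function.Injective φ) (x : (bar N) _⦋n⦌) :
    x ∈ (Subcomplex.range (barMap φ)).obj _ ↔
      ∀ (i j : Fin (n + 1)) (h : i ≤ j), arrow x h ∈ Set.range φ := by
  constructor
  · rintro ⟨y, rfl⟩ i j h
    exact ⟨arrow (M := M) y h, rfl⟩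
  · intro h
    choose a ha using h
    exact ⟨show Fin (n + 1) ⥤ SingleObj M from
      { obj := fun _ => SingleObj.star M
        map := fun {i j} f => a i j (leOfHom f)
        map_id := fun i => hφ (by
          rw [ha, arrow_self]
          exact (map_one φ).symm)
        map_comp := fun {i j k} f g => hφ (by
          rw [SingleObj.comp_as_mul, map_mul, ha, ha, ha, arrow_comp]) },
      bar_ext fun i j hij => ha i j hij⟩

lemma mono_barMap {M N : Type} [Monoid M] [Monoid N] {φ : M →* N}
    (hφ : Function.Injective φ) : Mono (barMap φ) := by
  have : ∀ m, Mono ((barMap φ).app m) := by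
    intro m
    induction m using Opposite.rec with | _ m
    induction m with | _ d
    rw [mono_iff_injective]
    intro x y h
    refine bar_ext fun i j hij => hφ ?_
    exact congrArg (fun x => arrow (M := N) x hij) h
  exact NatTrans.mono_of_mono_app _

lemma listSimplex_mem_range {M : Type} [Monoid M] {φ : M →* G} (hφ : Function.Injective φ)
    {w : List G} (hw : w.length = n + 1) :
    listSimplex w hw ∈ (Subcomplex.range (barMap φ)).obj _ ↔
      w.Pairwise fun a b => b * a⁻¹ ∈ Set.range φ := by
  rw [List.pairwise_iff_get, mem_range_barMap hφ]
  constructor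
  · intro h i j hij
    exact h (i.cast hw) (j.cast hw) (Fin.le_def.2 hij.le)
  · intro h i j hij
    obtain hij | rfl := hij.lt_or_eq
    · exact h _ _ (Fin.lt_def.2 hij)
    · exact ⟨1, by rw [arrow_self, map_one]⟩

end Words


/-! ### Regular pairings -/

/-- If all the horns of a regular pairing of `A` are local, then so is the inclusion of `A`. -/
lemma localClass_of_pairing {X : SimplicialObject SSet.{0}} {K : SSet.{0}} {A : K.Subcomplex}
    (P : A.Pairing) [P.IsRegular]
    (h : ∀ s : P.II, localClass X (horn _ ((P.isUniquelyCodimOneFace s).index rfl)).ι) :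
    localClass X A.ι :=
  MorphismProperty.transfiniteCompositionsOfShape_le (localClass X) ℕ _
    ⟨P.rankFunction.relativeCellComplex.toTransfiniteCompositionOfShape, fun j hj => by
      refine (?_ : (_ : MorphismProperty _) ≤ _) _
        (P.rankFunction.relativeCellComplex.attachCells j hj).pushouts_coproducts
      simp only [MorphismProperty.pushouts_le_iff, MorphismProperty.coproducts_le_iff]
      rintro _ _ _ ⟨c⟩
      exact h c.s⟩

lemma localClass_of_pairingCore {X : SimplicialObject SSet.{0}} {K : SSet.{0}} {A : K.Subcomplex}
    (P : A.PairingCore) [P.IsRegular]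
    (h : ∀ s : P.ι, localClass X (horn _ (P.index s)).ι) : localClass X A.ι := by
  refine localClass_of_pairing P.pairing fun s => ?_
  obtain ⟨s, rfl⟩ := P.equivII.surjective s
  have key : ∀ (x y y' : K.S) (e : y = y') (h₁ : S.IsUniquelyCodimOneFace x y)
      (h₂ : S.IsUniquelyCodimOneFace x y'), localClass X (horn _ (h₁.index rfl)).ι →
      localClass X (horn _ (h₂.index rfl)).ι := by
    rintro x y _ rfl h₁ h₂ h
    exact h
  have hs := h s
  rw [← P.isUniquelyCodimOneFace_index s] at hs
  refine key _ _ _ ?_ _ (P.pairing.isUniquelyCodimOneFace (P.equivII s)) hs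
  rw [P.type₁_pairing s]

end ContMonoid

namespace ContMonoid

/-! ### The pairing of simplices given by insertions -/

namespace Insertion

variable {V W : Type*}

/-- The image of an insertion under a map of letters. -/
def map (f : V → W) (t : Insertion V) : Insertion W :=
  ⟨t.p.map f, f t.a, f t.u, t.mid.map f, t.tl.map f, t.block⟩

lemma lower_map (f : V → W) (t : Insertion V) : (t.map f).lower = t.lower.map f := by
  simp [lower, map]

lemma upper_map (f : V → W) (t : Insertion V) : (t.map f).upper = t.upper.map f := by
  simp [upper, map]

lemma rank_map (f : V → W) (t : Insertion V) : (t.map f).rank = t.rank := by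
  simp [rank, map]

lemma lower_sublist_upper (t : Insertion V) : t.lower.Sublist t.upper := by
  simp [lower, upper]

/-- One less than the number of letters of `lower`, that is, its dimension as a simplex. -/
def dim (t : Insertion V) : ℕ := t.p.length + (t.mid.length + t.tl.length)

lemma length_lower (t : Insertion V) : t.lower.length = t.dim + 1 := by
  simp [lower, dim]; omega

lemma length_upper (t : Insertion V) : t.upper.length = t.dim + 2 := by
  simp [upper, dim]; omega

lemma eraseIdx_upper (t : Insertion V) : t.upper.eraseIdx (t.p.length + 1) = t.lower := by
  simp [upper, lower, List.eraseIdx_append_of_length_le]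

lemma head?_upper (t : Insertion V) : t.upper.head? = t.lower.head? := by
  obtain ⟨_ | _, _, _, _, _, _⟩ := t <;> simp [upper, lower]

end Insertion

lemma ScaledPreorder.IsValid.map {V : Type*} {S : ScaledPreorder V} {t : Insertion V}
    (h : S.IsValid t) (e : V ≃ V) (hle : ∀ a b, S.le (e a) (e b) ↔ S.le a b)
    (hsim : ∀ a b, S.sim (e a) (e b) ↔ S.sim a b) : S.IsValid (t.map e) where
  isBlock hb := by
    have H := h.isBlock hb
    exact
      { sim_p := by simpa [Insertion.map, hsim] using H.sim_p
        sim_mid := by simpa [Insertion.map, hsim] using H.sim_mid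
        sim_tl := by simpa [Insertion.map, hsim] using H.sim_tl
        not_le := by simpa [Insertion.map, hle] using H.not_le
        lub := e.surjective.forall.2 fun x => by
          rw [show (t.map e).p ++ [(t.map e).a] = (t.p ++ [t.a]).map e by simp [Insertion.map],
            List.forall_mem_map]
          simpa only [Insertion.map, hle, hsim] using H.lub x
        chain := by
          simpa [Insertion.map, hle, List.pairwise_map] using H.chain }
  isBreak hb := by
    obtain ⟨b, tl, htl, H⟩ := h.isBreak hb
    refine ⟨e b, tl.map e, by simp [Insertion.map, htl], ?_⟩
    exact
      { chain := by
          rw [show (t.map e).p ++ [(t.map e).a] ++ (t.map e).u :: (t.map e).mid =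
            (t.p ++ [t.a] ++ t.u :: t.mid).map e by simp [Insertion.map], List.pairwise_map]
          simpa only [hle] using H.chain
        sim_mid := by simpa [Insertion.map, hle, hsim] using H.sim_mid
        not_mid := by simpa [Insertion.map, hle, hsim] using H.not_mid
        lub := e.surjective.forall.2 fun x => by
          simpa [Insertion.map, hle, hsim] using H.lub x
        break_ := by
          rw [show (t.map e).p ++ [(t.map e).a] ++ (t.map e).mid ++ [e b] =
            (t.p ++ [t.a] ++ t.mid ++ [b]).map e by simp [Insertion.map], List.pairwise_map]
          simpa only [hle] using H.break_
        not_sim := by simpa [Insertion.map, hle, hsim] using H.not_sim }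
  lower_ne := by
    rw [Insertion.lower_map, List.isChain_map]
    simpa using h.lower_ne
  upper_ne := by
    rw [Insertion.upper_map, List.isChain_map]
    simpa using h.upper_ne

lemma pairwise_sim_iff {V : Type*} (S : ScaledPreorder V) {w : List V} {a : V} (ha : a ∈ w) :
    w.Pairwise S.sim ↔ ∀ x ∈ w, S.sim x a := by
  constructor
  · intro h
    have : Std.Symm S.sim := ⟨fun _ _ h => S.sim_symm h⟩
    exact fun x hx => List.Pairwise.forall_of_forall (fun x _ => S.sim_refl x) h hx ha
  · intro h
    rw [List.pairwise_iff_forall_sublist]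
    intro x y hxy
    have := hxy.subset
    exact S.sim_trans (h x (this (by simp))) (S.sim_symm (h y (this (by simp))))

lemma _root_.List.eq_of_eraseIdx_eq {V : Type*} {w : List V} (hw : w.IsChain (· ≠ ·)) {i j : ℕ}
    (hi : i < w.length) (hj : j < w.length) (h : w.eraseIdx i = w.eraseIdx j) : i = j := by
  wlog hij : i < j generalizing i j
  · obtain hij | hij := (not_lt.1 hij).lt_or_eq
    · exact (this hj hi h.symm hij).symm
    · exact hij.symm
  have h₁ : (w.eraseIdx i)[i]? = (w.eraseIdx j)[i]? := by rw [h]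
  rw [List.getElem?_eraseIdx_of_ge le_rfl, List.getElem?_eraseIdx_of_lt hij] at h₁
  have := List.isChain_iff_getElem.1 hw i (by omega)
  rw [List.getElem?_eq_getElem (by omega), List.getElem?_eq_getElem (by omega)] at h₁
  exact (this (Option.some_injective _ h₁.symm)).elim

section

open SSet

variable {G : Type} [Group G]

/-- The data to which the pairing applies: a scaled preorder on `G` invariant under
right translations, and a subcomplex `A` of the bar construction that consists of the increasing
words and, if `E` holds, of the words whose letters are multiples of each other. -/
structure IsWordSubcomplex (S : ScaledPreorder G) (E : Prop) (A : (bar G).Subcomplex) : Prop where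
  le_iff (a b c : G) : S.le (a * c) (b * c) ↔ S.le a b
  sim_iff (a b c : G) : S.sim (a * c) (b * c) ↔ S.sim a b
  mem_iff (n : ℕ) (w : List G) (hw : w.length = n + 1) : listSimplex w hw ∈ A.obj _ ↔
    w.Pairwise S.le ∨ (E ∧ w.Pairwise S.sim)

/-- The insertions that index the pairing: words are normalized to start with `1`. -/
def WordInsertion (S : ScaledPreorder G) (E : Prop) : Type :=
  {t : Insertion G // S.IsValid t ∧ t.lower.head? = some 1 ∧ (E → ¬ t.lower.Pairwise S.sim)}

variable {S : ScaledPreorder G} {E : Prop} {A : (bar G).Subcomplex}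

/-- A translate of the lower word of an insertion can be a subword of the upper word of
another one only if the rank increases. -/
lemma WordInsertion.eq_or_rank_lt (H : IsWordSubcomplex S E A) (s t : WordInsertion S E) (c : G)
    (h : (s.1.lower.map (· * c)).Sublist t.1.upper) :
    (s = t ∧ c = 1) ∨ s.1.rank < t.1.rank := by
  have hs : S.IsValid (s.1.map (· * c)) :=
    s.2.1.map (Equiv.mulRight c) (fun a b => H.le_iff a b c) (fun a b => H.sim_iff a b c)
  obtain h' | h' := hs.eq_or_rank_lt t.2.1 (by rwa [Insertion.lower_map])
  · have hc : c = 1 := by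
      have := t.2.2.1
      rw [← h', Insertion.lower_map, List.head?_map, s.2.2.1] at this
      simpa using this
    refine Or.inl ⟨Subtype.ext ?_, hc⟩
    rw [← h', hc]
    simp [Insertion.map]
  · exact Or.inr (by rwa [Insertion.rank_map] at h')

lemma WordInsertion.eq_of_lower_sublist (H : IsWordSubcomplex S E A) {s t : WordInsertion S E}
    (h : s.1.lower.Sublist t.1.upper) (h' : t.1.lower.Sublist s.1.upper) : s = t := by
  obtain h | h := s.eq_or_rank_lt H t 1 (by simpa using h)
  · exact h.1
  obtain h' | h' := t.eq_or_rank_lt H s 1 (by simpa using h')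
  · exact h'.1.symm
  · exact (lt_asymm h h').elim

/-- Words that start with `1` are determined by their simplices. -/
lemma eq_of_listSimplex_eq {w w' : List G} {n m : ℕ} {hw : w.length = n + 1}
    {hw' : w'.length = m + 1} (h : SSet.S.mk (listSimplex w hw) = SSet.S.mk (listSimplex w' hw'))
    (h₁ : w.head? = some 1) (h₂ : w'.head? = some 1) : w = w' := by
  obtain ⟨c, rfl⟩ := listSimplex_eq hw hw' h
  rw [List.head?_map, h₁] at h₂
  obtain rfl : c = 1 := by simpa using h₂
  simp

namespace WordInsertion

/-- The simplex given by the upper word. -/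
def upperSimplex (t : WordInsertion S E) : (bar G) _⦋t.1.dim + 1⦌ :=
  listSimplex t.1.upper t.1.length_upper

/-- The simplex given by the lower word. -/
def lowerSimplex (t : WordInsertion S E) : (bar G) _⦋t.1.dim⦌ :=
  listSimplex t.1.lower t.1.length_lower

/-- The position of the inserted letter. -/
def index (t : WordInsertion S E) : Fin (t.1.dim + 2) :=
  ⟨t.1.p.length + 1, by simp [Insertion.dim]⟩

lemma δ_index (t : WordInsertion S E) : (bar G).δ t.index t.upperSimplex = t.lowerSimplex :=
  δ_listSimplex _ _ _ t.1.eraseIdx_upper.symm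

lemma notMem_lower (H : IsWordSubcomplex S E A) (t : WordInsertion S E) :
    t.lowerSimplex ∉ A.obj _ := by
  rw [lowerSimplex, H.mem_iff]
  rintro (h | ⟨hE, h⟩)
  · exact t.2.1.not_pairwise_lower h
  · exact t.2.2.2 hE h

lemma notMem_upper (H : IsWordSubcomplex S E A) (t : WordInsertion S E) :
    t.upperSimplex ∉ A.obj _ := fun h => t.notMem_lower H (by
  rw [← t.δ_index]
  exact A.map _ h)

lemma exists_eq (H : IsWordSubcomplex S E A) (x : A.N) : ∃ t : WordInsertion S E,
    x.toS = SSet.S.mk t.upperSimplex ∨ x.toS = SSet.S.mk t.lowerSimplex := by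
  obtain ⟨w, n, hw, hw1, hx⟩ := exists_eq_listSimplex x.toS
  have key : ∀ y : (bar G).S, y = SSet.S.mk (listSimplex w hw) →
      y.simplex ∈ (bar G).nonDegenerate y.dim → y.simplex ∉ A.obj _ →
      w.IsChain (· ≠ ·) ∧ ¬ (w.Pairwise S.le ∨ (E ∧ w.Pairwise S.sim)) := by
    rintro _ rfl h₁ h₂
    exact ⟨(listSimplex_mem_nonDegenerate hw).1 h₁, fun h => h₂ ((H.mem_iff n w hw).2 h)⟩
  obtain ⟨hnd, hA⟩ := key _ hx x.nonDegenerate x.notMem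
  rw [hx]
  push Not at hA
  obtain ⟨t, ht, hw'⟩ := S.exists_isValid hnd hA.1
  have ha : t.a ∈ t.lower := by simp [Insertion.lower]
  have hE : E → ¬ t.lower.Pairwise S.sim := fun hE h => hA.2 hE (by
    obtain rfl | rfl := hw'
    · exact h
    · exact (pairwise_sim_iff S (t.lower_sublist_upper.subset ha)).2
        (ht.sim_upper ((pairwise_sim_iff S ha).1 h)))
  obtain rfl | rfl := hw'
  · refine ⟨⟨t, ht, hw1, hE⟩, Or.inr ?_⟩
    obtain rfl : n = t.dim := by have := t.length_lower; omega
    rfl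
  · refine ⟨⟨t, ht, t.head?_upper ▸ hw1, hE⟩, Or.inl ?_⟩
    obtain rfl : n = t.dim + 1 := by have := t.length_upper; omega
    rfl

/-- Words and their insertions form a pairing of the simplices of the bar construction that
do not belong to `A`. -/
def pairingCore (H : IsWordSubcomplex S E A) : A.PairingCore where
  ι := WordInsertion S E
  dim t := t.1.dim
  simplex t := t.upperSimplex
  index t := t.index
  nonDegenerate₁ t := (listSimplex_mem_nonDegenerate _).2 t.2.1.upper_ne
  nonDegenerate₂ t := by
    rw [δ_index]
    exact (listSimplex_mem_nonDegenerate _).2 t.2.1.lower_ne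
  notMem₁ t := t.notMem_upper H
  notMem₂ t := by
    rw [δ_index]
    exact t.notMem_lower H
  injective_type₁' {s t} h := by
    have h := eq_of_listSimplex_eq h (s.1.head?_upper.trans s.2.2.1) (t.1.head?_upper.trans t.2.2.1)
    exact eq_of_lower_sublist H (h ▸ s.1.lower_sublist_upper) (h ▸ t.1.lower_sublist_upper)
  injective_type₂' {s t} h := by
    rw [δ_index, δ_index] at h
    have h := eq_of_listSimplex_eq h s.2.2.1 t.2.2.1
    exact eq_of_lower_sublist H (h ▸ t.1.lower_sublist_upper) (h ▸ s.1.lower_sublist_upper)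
  type₁_ne_type₂' s t h := by
    rw [δ_index] at h
    have h := eq_of_listSimplex_eq h (s.1.head?_upper.trans s.2.2.1) t.2.2.1
    obtain rfl := eq_of_lower_sublist (s := s) (t := t) H
      (s.1.lower_sublist_upper.trans (h ▸ t.1.lower_sublist_upper)) (by rw [h])
    have := congrArg List.length h
    rw [Insertion.length_upper, Insertion.length_lower] at this
    omega
  surjective' x := by
    simp only [δ_index]
    exact exists_eq H x

instance (H : IsWordSubcomplex S E A) : (pairingCore H).IsProper where
  isUniquelyCodimOneFace t := by
    -- Another face that gives the lower word would give a translate of the lower word, inside the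
    -- upper word; it would have the same rank.
    refine (SSet.S.IsUniquelyCodimOneFace.iff _ _).2 ⟨t.index, rfl, fun i hi => ?_⟩
    change WordInsertion S E at t
    change Fin (t.1.dim + 2) at i
    change (bar G).δ i t.upperSimplex = (bar G).δ t.index t.upperSimplex at hi
    have hlen : (t.1.upper.eraseIdx i).length = t.1.dim + 1 := by
      rw [List.length_eraseIdx_of_lt (by rw [Insertion.length_upper]; exact i.isLt),
        Insertion.length_upper]
      rfl
    rw [δ_index, upperSimplex, δ_listSimplex _ hlen _ rfl] at hi
    obtain ⟨c, hc⟩ := listSimplex_eq t.1.length_lower hlen (congrArg SSet.S.mk hi.symm)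
    obtain ⟨-, rfl⟩ | h := t.eq_or_rank_lt H t c (hc ▸ List.eraseIdx_sublist _ _)
    · refine Fin.ext (List.eq_of_eraseIdx_eq t.2.1.upper_ne (by
        rw [Insertion.length_upper]; exact i.isLt) (by
        rw [Insertion.length_upper]; exact t.index.isLt) ?_)
      rw [hc, show ((t.index : Fin _) : ℕ) = t.1.p.length + 1 from rfl, t.1.eraseIdx_upper]
      simp
    · exact (lt_irrefl _ h).elim

instance (H : IsWordSubcomplex S E A) : (pairingCore H).IsRegular :=
  (show (pairingCore H).RankFunction (ℕ ×ₗ ℕ ×ₗ ℕ ×ₗ ℕ) from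
    { rank := fun t : WordInsertion S E => t.1.rank
      lt := fun {s t} h => by
        change WordInsertion S E at s t
        have h₁ : SSet.S.mk ((bar G).δ s.index s.upperSimplex) ≤ SSet.S.mk t.upperSimplex := h.2.le
        rw [δ_index] at h₁
        obtain ⟨c, hc⟩ := listSimplex_le _ _ s.2.1.lower_ne h₁
        exact (s.eq_or_rank_lt H t c hc).resolve_left fun h' => h.1 h'.1 }).isRegular

end WordInsertion

open WordInsertion in
/-- Let `A` consist of the increasing words and the words of multiples. Its inclusion is built
from inner horns only. -/
theorem IsWordSubcomplex.localClass_ι (H : IsWordSubcomplex S True A)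
    {X : SimplicialObject SSet.{0}} (hX : IsContinuousMonoid X) : localClass X A.ι := by
  refine localClass_of_pairingCore (pairingCore H) fun t => ?_
  change WordInsertion S True at t
  refine localClass_inner_horn hX (i := t.index) (Fin.pos_iff_ne_zero.2 ?_) ?_
  · simp [index, Fin.ext_iff]
  · rw [Fin.lt_def]
    change t.1.p.length + 1 < t.1.dim + 1
    have : t.1.mid ++ t.1.tl ≠ [] := fun h => t.2.2.2 trivial
      ((pairwise_sim_iff S (by simp [Insertion.lower])).2 (t.2.1.sim_lower_of_eq_nil h))
    have := List.length_pos_of_ne_nil this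
    simp only [List.length_append] at this
    simp only [Insertion.dim]
    omega

open WordInsertion in
/-- Let `A` consist of the increasing words. Its inclusion is built from inner horns
and last horns. -/
theorem IsWordSubcomplex.localClass_ι_of_group (H : IsWordSubcomplex S False A)
    {X : SimplicialObject SSet.{0}} (hX : IsContinuousGroup X) : localClass X A.ι := by
  refine localClass_of_pairingCore (pairingCore H) fun t => ?_
  change WordInsertion S False at t
  change localClass X (horn _ t.index).ι
  by_cases h : t.index = Fin.last _
  · rw [h]
    refine localClass_last_horn hX ?_
    have := t.2.1.p_or_tl_ne_nil
    rw [← List.length_pos_iff, ← List.length_pos_iff, List.length_append] at this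
    simp only [Insertion.dim]
    omega
  · exact localClass_inner_horn hX.toIsContinuousMonoid
      (Fin.pos_iff_ne_zero.2 (by simp [index, Fin.ext_iff])) (Fin.lt_last_iff_ne_last.2 h)

end

end ContMonoid

namespace ContMonoid

open SSet Limits

/-! ### Monoids of fractions with scalars -/

/-- A submonoid `φ : M → G` of a group and a subgroup of "scalars" `ψ : Q → G` such that the
only scalar unit of `M` is `1`, and such that the scalars `q` for which `ψ q` and `ψ q * g` both
belong to `M` are those in `M r` for a single scalar `r`. -/
structure HasScalarDenominators {M G Q : Type} [Monoid M] [Group G] [Group Q]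
    (φ : M →* G) (ψ : Q →* G) : Prop where
  injective : Function.Injective φ
  injective_scalars : Function.Injective ψ
  eq_one (q : Q) : ψ q ∈ Set.range φ → (ψ q)⁻¹ ∈ Set.range φ → ψ q = 1
  exists_denominator (g : G) : ∃ r : Q, ∀ q : Q,
    ψ q * (ψ r)⁻¹ ∈ Set.range φ ↔ ψ q * g ∈ Set.range φ ∧ ψ q ∈ Set.range φ

namespace HasScalarDenominators

variable {M G Q : Type} [Monoid M] [Group G] [Group Q] {φ : M →* G} {ψ : Q →* G}

/-- The preorder on `G` for which `a ≤ b` if `b ∈ M a`, with the equivalence relation `b ∈ Q a`. -/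
def scaledPreorder (H : HasScalarDenominators φ ψ) : ScaledPreorder G where
  le a b := b * a⁻¹ ∈ Set.range φ
  sim a b := b * a⁻¹ ∈ Set.range ψ
  le_refl a := ⟨1, by simp⟩
  le_trans {a b c} := by
    rintro ⟨x, hx⟩ ⟨y, hy⟩
    exact ⟨y * x, by rw [map_mul, hx, hy]; group⟩
  sim_refl a := ⟨1, by simp⟩
  sim_symm {a b} := by
    rintro ⟨x, hx⟩
    exact ⟨x⁻¹, by rw [map_inv, hx]; group⟩
  sim_trans {a b c} := by
    rintro ⟨x, hx⟩ ⟨y, hy⟩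
    exact ⟨y * x, by rw [map_mul, hx, hy]; group⟩
  antisymm {a b} := by
    rintro ⟨q, hq⟩ h₁ h₂
    have := H.eq_one q (by rwa [hq]) (by rw [hq]; simpa using h₂)
    rw [hq, mul_inv_eq_one] at this
    exact this.symm
  exists_lub a b := by
    obtain ⟨r, hr⟩ := H.exists_denominator (b * a⁻¹)
    -- The letters in the class of `b` are the `q b`; those above `a` and `b` are the `q b` with
    -- both `q (b a⁻¹)` and `q` in `M`.
    refine ⟨ψ r * b, ⟨r⁻¹, by rw [map_inv]; group⟩, ?_⟩
    rintro x ⟨q, hq⟩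
    obtain rfl : x = (ψ q)⁻¹ * b := by rw [hq]; group
    have := hr q⁻¹
    rw [map_inv] at this
    convert this using 2
    · group
    · congr! 1
      group
    · group

lemma isWordSubcomplex_range (H : HasScalarDenominators φ ψ) :
    IsWordSubcomplex H.scaledPreorder False (Subcomplex.range (barMap φ)) where
  le_iff a b c := by simp [scaledPreorder, mul_assoc]
  sim_iff a b c := by simp [scaledPreorder, mul_assoc]
  mem_iff n w hw := by
    rw [listSimplex_mem_range H.injective]
    simp [scaledPreorder]

lemma isWordSubcomplex_sup (H : HasScalarDenominators φ ψ) :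
    IsWordSubcomplex H.scaledPreorder True
      (Subcomplex.range (barMap φ) ⊔ Subcomplex.range (barMap ψ)) where
  le_iff a b c := by simp [scaledPreorder, mul_assoc]
  sim_iff a b c := by simp [scaledPreorder, mul_assoc]
  mem_iff n w hw := by
    rw [mem_sup_obj, listSimplex_mem_range H.injective,
      listSimplex_mem_range H.injective_scalars]
    simp [scaledPreorder]

/-- The bar construction of `G` is obtained from that of `M` by filling inner and last horns. -/
theorem isGroupCompletion (H : HasScalarDenominators φ ψ) : IsGroupCompletion φ := by
  intro X hX
  have := mono_barMap H.injective
  have h : localClass X (barMap φ) := by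
    rw [← Subcomplex.toRange_ι (barMap φ)]
    exact (localClass X).comp_mem _ _ ((localClass X).of_isIso _)
      (H.isWordSubcomplex_range.localClass_ι_of_group hX)
  exact IsTrivialFibration.isEquivalence h

end HasScalarDenominators

section

variable {A B C D : Type} [Monoid A] [Monoid B] [Monoid C] [Monoid D]
    {f : A →* C} {i : A →* B} {h : C →* D} {g : B →* D}

/-- A pullback square of injective homomorphisms of monoids induces a pushout square onto the union
of the images in the bar construction of `D`. -/
lemma isPushout_range_sup (comm : h.comp f = g.comp i) (hi : Function.Injective i)
    (hh : Function.Injective h) (hg : Function.Injective g)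
    (hpb : ∀ c b, h c = g b → ∃ a, f a = c ∧ i a = b) :
    IsPushout (barMap f) (barMap i)
      (Subcomplex.toRange (barMap h) ≫ Subcomplex.homOfLE
        (le_sup_left (a := Subcomplex.range (barMap h)) (b := Subcomplex.range (barMap g))))
      (Subcomplex.toRange (barMap g) ≫ Subcomplex.homOfLE le_sup_right) := by
  have := mono_barMap hh
  have := mono_barMap hg
  have hgi : Function.Injective (g.comp i) := hg.comp hi
  have := mono_barMap hgi
  have heq : Subcomplex.range (barMap (g.comp i)) =
      Subcomplex.range (barMap h) ⊓ Subcomplex.range (barMap g) := by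
    ext m x
    induction m using Opposite.rec with | _ m
    induction m with | _ d
    rw [mem_inf_obj, mem_range_barMap hgi, mem_range_barMap hh, mem_range_barMap hg]
    constructor
    · intro H
      refine ⟨fun k l hkl => ?_, fun k l hkl => ?_⟩
      · obtain ⟨a, ha⟩ := H k l hkl
        exact ⟨f a, by rw [← ha, ← comm]; rfl⟩
      · obtain ⟨a, ha⟩ := H k l hkl
        exact ⟨i a, ha⟩
    · rintro ⟨H₁, H₂⟩ k l hkl
      obtain ⟨c, hc⟩ := H₁ k l hkl
      obtain ⟨b, hb⟩ := H₂ k l hkl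
      obtain ⟨a, -, ha⟩ := hpb c b (hc.trans hb.symm)
      exact ⟨a, by rw [← hb, ← ha]; rfl⟩
  have sq : Subcomplex.BicartSq
      (Subcomplex.range (barMap h) ⊓ Subcomplex.range (barMap g))
      (Subcomplex.range (barMap h)) (Subcomplex.range (barMap g))
      (Subcomplex.range (barMap h) ⊔ Subcomplex.range (barMap g)) := ⟨rfl, rfl⟩
  have hcomp : barMap f ≫ barMap h = barMap (g.comp i) := by
    rw [← comm]; rfl
  refine IsPushout.of_iso' sq.isPushout
    (asIso (Subcomplex.toRange (barMap (g.comp i))) ≪≫ Subcomplex.eqToIso heq)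
    (asIso (Subcomplex.toRange (barMap h))) (asIso (Subcomplex.toRange (barMap g)))
    (Iso.refl _) ?_ ?_ ?_ ?_
  · rw [← cancel_mono (Subcomplex.ι _)]
    exact hcomp.symm
  · rw [← cancel_mono (Subcomplex.ι _)]
    rfl
  · exact (Category.comp_id _).symm
  · exact (Category.comp_id _).symm

/-- Mapping spaces take a pushout `Q` to a fibre product. Accordingly, lifting against the
comparison map from the mapping space of `R` to the fibre product amounts to lifting against
restriction along `r : Q ⟶ R`. -/
lemma hasLiftingProperty_pullback_lift {X : SimplicialObject SSet.{0}} {K L P Q R : SSet.{0}}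
    {f : K ⟶ L} {i : K ⟶ P} {h : L ⟶ Q} {g : P ⟶ Q} (sq : IsPushout f i h g) (r : Q ⟶ R)
    {U V : SSet.{0}} (k : U ⟶ V) (hr : HasLiftingProperty k (mapSpace.precomp r X))
    (w : mapSpace.precomp (g ≫ r) X ≫ mapSpace.precomp i X =
      mapSpace.precomp (h ≫ r) X ≫ mapSpace.precomp f X) :
    HasLiftingProperty k (pullback.lift (mapSpace.precomp (g ≫ r) X)
      (mapSpace.precomp (h ≫ r) X) w) := by
  refine ⟨fun {a b} sq' => ?_⟩
  have hb : i ≫ swap (b ≫ pullback.fst _ _) = f ≫ swap (b ≫ pullback.snd _ _) := by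
    rw [← swap_precomp, ← swap_precomp, Category.assoc, Category.assoc, pullback.condition]
  let c : V ⟶ mapSpace Q X := swap (X := transpose X) (sq.desc _ _ hb.symm)
  have hc₁ : c ≫ mapSpace.precomp g X = b ≫ pullback.fst _ _ :=
    congrArg (swap (X := transpose X)) (sq.inr_desc _ _ hb.symm)
  have hc₂ : c ≫ mapSpace.precomp h X = b ≫ pullback.snd _ _ :=
    congrArg (swap (X := transpose X)) (sq.inl_desc _ _ hb.symm)
  have ha₁ : a ≫ mapSpace.precomp (g ≫ r) X = k ≫ b ≫ pullback.fst _ _ := by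
    rw [← sq'.w_assoc, pullback.lift_fst]
  have ha₂ : a ≫ mapSpace.precomp (h ≫ r) X = k ≫ b ≫ pullback.snd _ _ := by
    rw [← sq'.w_assoc, pullback.lift_snd]
  have sq'' : CommSq a k (mapSpace.precomp r X) c := ⟨by
    suffices H : swap (a ≫ mapSpace.precomp r X) = swap (k ≫ c) from
      congrArg (swap (X := transpose X)) H
    refine sq.hom_ext ?_ ?_
    · rw [← swap_precomp, ← swap_precomp, Category.assoc, Category.assoc, hc₂, ← ha₂]
      rfl
    · rw [← swap_precomp, ← swap_precomp, Category.assoc, Category.assoc, hc₁, ← ha₁]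
      rfl⟩
  refine ⟨⟨sq''.lift, sq''.fac_left, ?_⟩⟩
  refine pullback.hom_ext ?_ ?_
  · rw [Category.assoc, pullback.lift_fst]
    exact Eq.trans (congrArg (· ≫ mapSpace.precomp g X) sq''.fac_right) hc₁
  · rw [Category.assoc, pullback.lift_snd]
    exact Eq.trans (congrArg (· ≫ mapSpace.precomp h X) sq''.fac_right) hc₂

end

/-- If `C` has denominators that are scalars in `B`, and the scalars that belong to `C` are
those in `A`, then `D` is the pushout of `B` and `C` over `A`. -/
theorem HasScalarDenominators.isPushout {A B C D : Type} [Monoid A] [Group B] [Monoid C] [Group D]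
    {f : A →* C} {i : A →* B} {h : C →* D} {g : B →* D} (H : HasScalarDenominators h g)
    (comm : h.comp f = g.comp i) (hi : Function.Injective i)
    (hpb : ∀ b, g b ∈ Set.range h → b ∈ Set.range i) :
    IsPushoutOfContinuousMonoids f i h g where
  comm := comm
  isHomotopyPullback X hX := by
    have hpb' : ∀ c b, h c = g b → ∃ a, f a = c ∧ i a = b := fun c b e => by
      obtain ⟨a, rfl⟩ := hpb b ⟨c, e⟩
      exact ⟨a, H.injective ((DFunLike.congr_fun comm a).trans e.symm), rfl⟩
    have w : restrict g X ≫ restrict i X = restrict h X ≫ restrict f X := by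
      change mapSpace.precomp (barMap (g.comp i)) X = mapSpace.precomp (barMap (h.comp f)) X
      rw [comm]
    have := mono_barMap hi
    refine ⟨w, _, 𝟙 _, restrict i X, Category.id_comp _, isEquivalence_id _,
      isKanFibration_precomp hX.reedyFibrant _, ?_⟩
    simp only [Category.comp_id]
    refine IsTrivialFibration.isEquivalence ?_
    rintro _ _ _ ⟨n⟩
    exact hasLiftingProperty_pullback_lift
      (isPushout_range_sup comm hi H.injective H.injective_scalars hpb')
      (Subcomplex.ι _) (boundary.{0} n).ι
      (H.isWordSubcomplex_sup.localClass_ι hX _ ⟨n⟩) w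

end ContMonoid

namespace ContMonoid

/-! ### Integer matrices -/

lemma coe_natToRat (n : ℕ+) : (natToRat n).1 = ((n : ℕ) : ℚ) := rfl

lemma injective_natToRat : Function.Injective natToRat := fun m n h => PNat.eq (by
  have := congrArg Subtype.val h
  rw [coe_natToRat, coe_natToRat] at this
  exact_mod_cast this)

lemma mem_range_natToRat (q : Pos ℚ) : q ∈ Set.range natToRat ↔ ∃ n : ℤ, (n : ℚ) = q.1 := by
  constructor
  · rintro ⟨n, rfl⟩
    exact ⟨(n : ℕ), by simp [natToRat]⟩
  · rintro ⟨n, hn⟩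
    have hpos : 0 < n := by
      have := q.2
      rw [← hn] at this
      exact_mod_cast this
    lift n to ℕ using hpos.le
    refine ⟨⟨n, by exact_mod_cast hpos⟩, Subtype.ext ?_⟩
    simpa [natToRat] using hn

lemma exists_int_mul_iff (k : ℕ) (x : ℚ) : (∃ n : ℤ, (n : ℚ) = k * x) ↔ x.den ∣ k := by
  constructor
  · rintro ⟨n, hn⟩
    have h : (n : ℚ) * x.den = k * x.num := by
      rw [hn, mul_assoc, Rat.mul_den_eq_num]
    have h' : (n * x.den : ℤ) = k * x.num := by exact_mod_cast h
    have h₁ : (x.den : ℤ) ∣ k * x.num := ⟨n, by rw [← h']; ring⟩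
    have h₂ : IsCoprime (x.den : ℤ) x.num :=
      (Int.isCoprime_iff_nat_coprime.2 (by simpa using x.reduced)).symm
    exact_mod_cast h₂.dvd_of_dvd_mul_right h₁
  · rintro ⟨d, rfl⟩
    refine ⟨d * x.num, ?_⟩
    push_cast
    rw [← Rat.mul_den_eq_num]
    ring

/-- Finitely many rationals have a least common denominator. -/
lemma exists_common_denominator {ι : Type} [Fintype ι] (c : ι → ℚ) : ∃ r : Pos ℚ, ∀ q : Pos ℚ,
    q * r⁻¹ ∈ Set.range natToRat ↔
      (∀ i, ∃ n : ℤ, (n : ℚ) = q.1 * c i) ∧ q ∈ Set.range natToRat := by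
  let d : ℕ := Finset.univ.lcm fun i => (c i).den
  have hd : 0 < d := Nat.pos_of_ne_zero (by
    simp [d, Finset.lcm_eq_zero_iff])
  obtain ⟨r, hr⟩ : ∃ r : ℕ+, (r : ℕ) = d := ⟨⟨d, hd⟩, rfl⟩
  refine ⟨natToRat r, fun q => ?_⟩
  constructor
  · rintro ⟨m, hm⟩
    obtain rfl : q = natToRat (m * r) := by rw [map_mul, hm, inv_mul_cancel_right]
    refine ⟨fun i => ?_, ⟨_, rfl⟩⟩
    refine (exists_int_mul_iff _ _).2 ?_
    rw [PNat.mul_coe, hr]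
    exact (Finset.dvd_lcm (Finset.mem_univ i)).trans (Dvd.intro_left (m : ℕ) rfl)
  · rintro ⟨h, m, rfl⟩
    obtain ⟨k, hk⟩ : r ∣ m := PNat.dvd_iff.2 (by
      rw [hr]
      exact Finset.lcm_dvd fun i _ => (exists_int_mul_iff _ _).1 (h i))
    exact ⟨k, by rw [hk, mul_comm r k, map_mul, mul_inv_cancel_right]⟩

/-- If membership in `M` of the multiples of `g` by scalars means that certain rational
coefficients are integers, then `M` has scalar denominators. -/
lemma HasScalarDenominators.of_coefficients {M G ι : Type} [Monoid M] [Group G] [Fintype ι]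
    {φ : M →* G} {ψ : Pos ℚ →* G} (hφ : Function.Injective φ) (hψ : Function.Injective ψ)
    (c : G → ι → ℚ) (hc : ∀ q g, ψ q * g ∈ Set.range φ ↔ ∀ i, ∃ n : ℤ, (n : ℚ) = q.1 * c g i)
    (hQ : ∀ q, ψ q ∈ Set.range φ ↔ q ∈ Set.range natToRat) : HasScalarDenominators φ ψ where
  injective := hφ
  injective_scalars := hψ
  eq_one q := by
    rw [← map_inv, hQ, hQ]
    rintro ⟨m, rfl⟩ ⟨n, hn⟩
    have h : natToRat (n * m) = 1 := by rw [map_mul, hn]; group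
    have h' : n * m = 1 := injective_natToRat (h.trans (map_one natToRat).symm)
    obtain rfl : m = 1 := PNat.eq (Nat.eq_one_of_mul_eq_one_left (congrArg PNat.val h'))
    rw [map_one, map_one]
  exists_denominator g := by
    obtain ⟨r, hr⟩ := exists_common_denominator (c g)
    refine ⟨r, fun q => ?_⟩
    rw [← map_inv, ← map_mul, hQ, hQ, hc, hr]

lemma hasScalarDenominators_natToRat :
    HasScalarDenominators natToRat (MonoidHom.id (Pos ℚ)) :=
  .of_coefficients (ι := Unit) injective_natToRat Function.injective_id (fun g _ => g.1)
    (fun q g => by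
      rw [mem_range_natToRat]
      simp) (fun q => Iff.rfl)

lemma exists_map_eq_smul_iff (q : ℚ) (g : Matrix (Fin 2) (Fin 2) ℚ) :
    (∃ A : Matrix (Fin 2) (Fin 2) ℤ,
      (Int.castRingHom ℚ).mapMatrix A = Matrix.scalar (Fin 2) q * g) ↔
      ∀ i : Fin 2 × Fin 2, ∃ n : ℤ, (n : ℚ) = q * g i.1 i.2 := by
  constructor
  · rintro ⟨A, hA⟩ i
    refine ⟨A i.1 i.2, ?_⟩
    have := congrFun (congrFun hA i.1) i.2
    simpa using this
  · intro h
    choose a ha using h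
    refine ⟨Matrix.of fun i j => a (i, j), ?_⟩
    ext i j
    simpa using ha (i, j)

lemma exists_map_eq_scalar_iff (q : Pos ℚ) :
    (∃ A : Matrix (Fin 2) (Fin 2) ℤ,
      (Int.castRingHom ℚ).mapMatrix A = Matrix.scalar (Fin 2) q.1) ↔
      q ∈ Set.range natToRat := by
  rw [mem_range_natToRat]
  constructor
  · rintro ⟨A, hA⟩
    have := congrFun (congrFun hA 0) 0
    exact ⟨A 0 0, by simpa using this⟩
  · rintro ⟨n, hn⟩
    refine ⟨Matrix.scalar (Fin 2) (n : ℤ), ?_⟩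
    ext i j
    rw [← hn, RingHom.mapMatrix_apply, Matrix.map_apply, scalar_apply, scalar_apply,
      diagonal_apply, diagonal_apply]
    split_ifs <;> simp

lemma mem_range_e2ToGL (x : GL (Fin 2) ℚ) : x ∈ Set.range e2ToGL ↔
    ∃ A : Matrix (Fin 2) (Fin 2) ℤ, (Int.castRingHom ℚ).mapMatrix A = x.1 := by
  constructor
  · rintro ⟨A, rfl⟩
    exact ⟨A.1, rfl⟩
  · rintro ⟨A, hA⟩
    refine ⟨⟨A, ?_⟩, Units.ext hA⟩
    change A.det ≠ 0
    have := det_intCast A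
    rw [hA] at this
    have hx := (GeneralLinearGroup.det x).ne_zero
    intro h0
    rw [h0] at this
    exact hx (by simpa using this)

lemma mem_range_e2PosToGLPos (x : GLPos (Fin 2) ℚ) : x ∈ Set.range e2PosToGLPos ↔
    ∃ A : Matrix (Fin 2) (Fin 2) ℤ, (Int.castRingHom ℚ).mapMatrix A = x.1.1 := by
  constructor
  · rintro ⟨A, rfl⟩
    exact ⟨A.1, rfl⟩
  · rintro ⟨A, hA⟩
    refine ⟨⟨A, ?_⟩, Subtype.ext (Units.ext hA)⟩
    change 0 < A.det
    have := det_intCast A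
    rw [hA] at this
    have hx : (0 : ℚ) < x.1.1.det := x.2
    rw [this] at hx
    exact_mod_cast hx

lemma mem_range_braidToCover (x : GLPosRatCover) :
    x ∈ Set.range braidToCover ↔ x.1.1 ∈ Set.range e2PosToGLPos := by
  constructor
  · rintro ⟨A, rfl⟩
    exact ⟨A.1.1, rfl⟩
  · rintro ⟨A, hA⟩
    refine ⟨⟨(A, x.1.2), ?_⟩, Subtype.ext (Prod.ext hA rfl)⟩
    have := x.2
    change glPosRatToReal x.1.1 = _ at this
    rw [← hA] at this
    exact this

lemma injective_e2ToGL : Function.Injective e2ToGL := fun A B h => by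
  refine Subtype.ext (Matrix.map_injective (Int.cast_injective (α := ℚ)) ?_)
  exact congrArg Units.val h

lemma injective_e2PosToGLPos : Function.Injective e2PosToGLPos := fun A B h => by
  refine Subtype.ext (Matrix.map_injective (Int.cast_injective (α := ℚ)) ?_)
  exact congrArg (fun x : GLPos (Fin 2) ℚ => x.1.1) h

lemma injective_braidToCover : Function.Injective braidToCover := fun A B h => by
  refine Subtype.ext (Prod.ext (injective_e2PosToGLPos ?_) ?_)
  · exact congrArg (fun x : GLPosRatCover => x.1.1) h
  · exact congrArg (fun x : GLPosRatCover => x.1.2) h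

lemma injective_scalarsGL : Function.Injective (scalarsGL ℚ) := fun _ _ h => by
  exact Subtype.ext (Matrix.scalar_inj.1 (congrArg Units.val h))

lemma injective_scalarsGLPos : Function.Injective (scalarsGLPos ℚ) := fun _ _ h =>
  injective_scalarsGL (congrArg Subtype.val h)

lemma injective_scalarsRatLift : Function.Injective scalarsRatLift := fun _ _ h =>
  injective_scalarsGLPos (congrArg (fun x : GLPosRatCover => x.1.1) h)

lemma scalarsGL_mem_range (q : Pos ℚ) :
    scalarsGL ℚ q ∈ Set.range e2ToGL ↔ q ∈ Set.range natToRat := by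
  rw [mem_range_e2ToGL]
  exact exists_map_eq_scalar_iff q

lemma scalarsGLPos_mem_range (q : Pos ℚ) :
    scalarsGLPos ℚ q ∈ Set.range e2PosToGLPos ↔ q ∈ Set.range natToRat := by
  rw [mem_range_e2PosToGLPos]
  exact exists_map_eq_scalar_iff q

lemma scalarsRatLift_mem_range (q : Pos ℚ) :
    scalarsRatLift q ∈ Set.range braidToCover ↔ q ∈ Set.range natToRat := by
  rw [mem_range_braidToCover]
  exact scalarsGLPos_mem_range q

lemma hasScalarDenominators_e2ToGL : HasScalarDenominators e2ToGL (scalarsGL ℚ) :=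
  .of_coefficients injective_e2ToGL injective_scalarsGL
    (fun g (i : Fin 2 × Fin 2) => g.1 i.1 i.2)
    (fun q g => by
      rw [mem_range_e2ToGL]
      exact exists_map_eq_smul_iff q.1 g.1) scalarsGL_mem_range

lemma hasScalarDenominators_e2PosToGLPos :
    HasScalarDenominators e2PosToGLPos (scalarsGLPos ℚ) :=
  .of_coefficients injective_e2PosToGLPos injective_scalarsGLPos
    (fun g (i : Fin 2 × Fin 2) => g.1.1 i.1 i.2)
    (fun q g => by
      rw [mem_range_e2PosToGLPos]
      exact exists_map_eq_smul_iff q.1 g.1.1) scalarsGLPos_mem_range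

lemma hasScalarDenominators_braidToCover : HasScalarDenominators braidToCover scalarsRatLift :=
  .of_coefficients injective_braidToCover injective_scalarsRatLift
    (fun g (i : Fin 2 × Fin 2) => g.1.1.1.1 i.1 i.2)
    (fun q g => by
      rw [mem_range_braidToCover, mem_range_e2PosToGLPos]
      exact exists_map_eq_smul_iff q.1 g.1.1.1.1) scalarsRatLift_mem_range

lemma e2ToGL_natScalars (n : ℕ+) : e2ToGL (natScalars n) = scalarsGL ℚ (natToRat n) :=
  congrArg Subtype.val (e2PosToGLPos_scalars n)

lemma braidToCover_natScalarsLift (n : ℕ+) :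
    braidToCover (natScalarsLift n) = scalarsRatLift (natToRat n) :=
  Subtype.ext (Prod.ext (e2PosToGLPos_scalars n) rfl)

end ContMonoid

end

theorem mainTheorem11 :
    -- the square from `E₂(ℤ)` to `GL₂(ℚ)` is a pushout
    IsPushoutOfContinuousMonoids natScalars natToRat e2ToGL (scalarsGL ℚ) ∧
    -- the square from the braid monoid to the universal cover of `GL₂⁺(ℚ)` is a pushout
    IsPushoutOfContinuousMonoids natScalarsLift natToRat braidToCover scalarsRatLift ∧
    -- group-completions
    IsGroupCompletion natToRat ∧
    IsGroupCompletion e2ToGL ∧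
    IsGroupCompletion braidToCover ∧
    IsGroupCompletion e2PosToGLPos := by
  refine ⟨?_, ?_, hasScalarDenominators_natToRat.isGroupCompletion,
    hasScalarDenominators_e2ToGL.isGroupCompletion,
    hasScalarDenominators_braidToCover.isGroupCompletion,
    hasScalarDenominators_e2PosToGLPos.isGroupCompletion⟩
  · exact hasScalarDenominators_e2ToGL.isPushout (MonoidHom.ext e2ToGL_natScalars)
      injective_natToRat fun b hb => (scalarsGL_mem_range b).1 hb
  · exact hasScalarDenominators_braidToCover.isPushout (MonoidHom.ext braidToCover_natScalarsLift)
      injective_natToRat fun b hb => (scalarsRatLift_mem_range b).1 hb
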